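/- Let $\Sigma$ be a finite alphabet and let $a,b,c\in\Sigma$ be pairwise distinct. **Ipomsets.** An *iposet* $(P,<,\dashrightarrow,S,T,\lambda)$ is a finite set $P$ with two strict partial orders $<$ (precedence) and $\dashrightarrow$ (event order) such that any two distinct events are related by $<$ or by $\dashrightarrow$ (in one direction or the other), a labelling $\lambda:P\to\Sigma$, a set $S\subseteq P$ of $<$-minimal source events and a set $T\subseteq P$ of $<$-maximal target events, where $<$ is an interval order (there are $\beta\le\eta:P\to\mathbb R$ with $x<y$ iff $\eta(x)<\beta(y)$). A *subsumption* $P\sqsubseteq Q$ is a bijection $P\to Q$ that respects $S,T,\lambda$, reflects $<$, and preserves $\dashrightarrow$ on $<$-incomparable events; an *isomorphism* is a bijection that respects $S,T,\lambda$, preserves and reflects $<$, and preserves and reflects $\dashrightarrow$ on $<$-incomparable events. *Ipomsets* are isomorphism classes of iposets. If the interfaces $T_P$ and $S_Q$ are isomorphic as labelled sets totally ordered by $\dashrightarrow$, the *gluing* $P*Q$ is $P\sqcup Q$ with $T_P$ and $S_Q$ identified, with interfaces $S_P$ and $T_Q$, event order the transitive closure of the union of the event orders, and $x<y$ iff $x<_Py$,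 or $x<_Qy$, or $x\in P\setminus T_P$ and $y\in Q\setminus S_Q$. A *loset* is a finite totally ordered ($\dashrightarrow$) $\Sigma$-labelled set, considered up to isomorphism; for a loset $U$ and $S,T\subseteq U$ let ${}_SU_T$ be the ipomset with empty precedence and interfaces $S,T$. A *language* is a set $L$ of ipomsets such that $P\sqsubseteq Q\in L$ implies $P\in L$; $X{\downarrow}=\{P\mid\exists Q\in X: P\sqsubseteq Q\}$; $P\backslash L=\{Q\mid P*Q\in L\}$. $L$ is *swap-invariant* if $PP'\in L$, $QQ'\in L$ and $P\sqsubseteq Q$ imply $QP'\in L$, for all ipomsets $P,Q,P',Q'$. **HDAs.** An *HDA* is a set $X$ of cells, each cell $x$ having a loset $\mathrm{ev}(x)$ of events, with lower and upper face maps $\delta^0_A,\delta^1_A$ for each $A\subseteq\mathrm{ev}(x)$ such that $\mathrm{ev}(\delta^\nu_A(x))=\mathrm{ev}(x)\setminus A$, $\delta^\nu_\emptyset=\mathrm{id}$, and, for disjoint $A,B$, $\delta^\nu_A\delta^\mu_B=\delta^\mu_B\delta^\nu_A$ and $\delta^\nu_A\delta^\nu_B=\delta^\nu_{A\cup B}$;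 and with sets of start cells and accept cells. A *path* is a sequence of cells connected by upsteps (from $\delta^0_A(x)$ to $x$) and downsteps (from $x$ to $\delta^1_A(x)$). Its *event ipomset* is the gluing of the ipomsets ${}_{U\setminus A}U_U$ for its upsteps and ${}_UU_{U\setminus A}$ for its downsteps, where $U=\mathrm{ev}(x)$; for the one-cell path $(x)$ it is ${}_UU_U$. The HDA *recognises* the set of event ipomsets of its paths from start to accept cells. A cell is *essential* if it lies on a path from a start cell to an accept cell. An HDA is *deterministic* if for each loset $U$ there is at most one start cell $x$ with $\mathrm{ev}(x)=U$, and for all losets $V$, $A\subseteq V$ and each essential cell $x$ with $\mathrm{ev}(x)=V\setminus A$ there is at most one essential cell $y$ with $\mathrm{ev}(y)=V$ and $\delta^0_A(y)=x$. HDAs may be infinite; a language is *regular* if a finite HDA recognises it and *deterministic* if some deterministic HDA recognises it. **Statement.** Let $a\parallel b$ be the ipomset of two $<$-incomparable events with $a\dashrightarrow b$ and empty interfaces, let words denote ipomsets linearly ordered by $<$, and let a $\bullet$ on the left or right of an event mark it as a source or target event. Let $L=\{a\parallel b,\ ab,\ ba,\ abc\}$. Then: 1. $L$ is a language, $L=\{a\parallel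 b,\ abc\}{\downarrow}$, and $L$ is regular; 2. $ab\bullet\ \sqsubseteq\ a\parallel b\bullet$ (where only $b$ is a target event), while $(ab\bullet)\backslash L=\{\bullet b,\ \bullet bc\}\neq\{\bullet b\}=(a\parallel b\bullet)\backslash L$; 3. $L$ is not swap-invariant; 4. $L$ is not deterministic. Hence not all HDAs are determinizable: there is a finite HDA recognising $L$ whose language is not the language of any deterministic HDA. -/

import Mathlib

universe u v

/-! ### Iposets and ipomsets -/

/-- An (interval) iposet over the alphabet `Sg`: a finite labelled poset with event order and with
source and target interfaces, whose precedence order is an interval order. -/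
structure Iposet (Sg : Type u) where
  carrier : Type
  finite : Finite carrier
  /-- precedence -/
  prec : carrier → carrier → Prop
  /-- event order -/
  evord : carrier → carrier → Prop
  label : carrier → Sg
  source : Set carrier
  target : Set carrier
  prec_irrefl : ∀ x, ¬ prec x x
  prec_trans : ∀ x y z, prec x y → prec y z → prec x z
  evord_irrefl : ∀ x, ¬ evord x x
  evord_trans : ∀ x y z, evord x y → evord y z → evord x z
  related : ∀ x y, x ≠ y → prec x y ∨ prec y x ∨ evord x y ∨ evord y x
  source_minimal : ∀ x ∈ source, ∀ y, ¬ prec y x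
  target_maximal : ∀ x ∈ target, ∀ y, ¬ prec x y
  /-- interval representation -/
  interval : ∃ b e : carrier → ℝ, (∀ x, b x ≤ e x) ∧ ∀ x y, prec x y ↔ e x < b y

namespace Iposet

variable {Sg : Type u}

/-- Two events are concurrent if neither precedes the other. -/
def Concurrent (P : Iposet Sg) (x y : P.carrier) : Prop := ¬ P.prec x y ∧ ¬ P.prec y x

/-- `f : P → Q` is a subsumption: a bijection which respects interfaces and labels, reflects
precedence and preserves essential event order. -/
structure IsSubsumption (P Q : Iposet Sg) (f : P.carrier → Q.carrier) : Prop where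
  bijective : Function.Bijective f
  source : f '' P.source = Q.source
  target : f '' P.target = Q.target
  label : ∀ x, Q.label (f x) = P.label x
  prec : ∀ x y, Q.prec (f x) (f y) → P.prec x y
  evord : ∀ x y, P.Concurrent x y → P.evord x y → Q.evord (f x) (f y)

/-- `f : P → Q` is an isomorphism of iposets. -/
structure IsIso (P Q : Iposet Sg) (f : P.carrier → Q.carrier) : Prop where
  bijective : Function.Bijective f
  source : f '' P.source = Q.source
  target : f '' P.target = Q.target
  label : ∀ x, Q.label (f x) = P.label x
  prec : ∀ x y, P.prec x y ↔ Q.prec (f x) (f y)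
  evord : ∀ x y, P.Concurrent x y → (P.evord x y ↔ Q.evord (f x) (f y))

/-- Isomorphism of iposets. -/
def Iso (P Q : Iposet Sg) : Prop := ∃ f, IsIso P Q f

theorem Iso.refl (P : Iposet Sg) : Iso P P :=
  ⟨id, Function.bijective_id, by simp, by simp, fun _ => rfl, fun _ _ => Iff.rfl,
    fun _ _ _ => Iff.rfl⟩

theorem Iso.symm {P Q : Iposet Sg} : Iso P Q → Iso Q P := by
  rintro ⟨f, hf⟩
  let e := Equiv.ofBijective f hf.bijective
  have he : ∀ y, f (e.symm y) = y := fun y => e.apply_symm_apply y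
  have hi : ∀ (s : Set P.carrier), e.symm '' (f '' s) = s := fun s => e.symm_image_image s
  refine ⟨e.symm, e.symm.bijective, ?_, ?_, fun x => ?_, fun x y => ?_, fun x y hxy => ?_⟩
  · rw [← hf.source, hi]
  · rw [← hf.target, hi]
  · rw [← hf.label, he]
  · rw [hf.prec, he, he]
  · rw [hf.evord, he, he]
    simpa [Concurrent, hf.prec, he] using hxy

theorem Iso.trans {P Q R : Iposet Sg} : Iso P Q → Iso Q R → Iso P R := by
  rintro ⟨f, hf⟩ ⟨g, hg⟩
  refine ⟨g ∘ f, hg.bijective.comp hf.bijective, ?_, ?_, fun x => ?_, fun x y => ?_,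
    fun x y hxy => ?_⟩
  · rw [Set.image_comp, hf.source, hg.source]
  · rw [Set.image_comp, hf.target, hg.target]
  · rw [Function.comp, hg.label, hf.label]
  · rw [hf.prec, hg.prec]; rfl
  · rw [hf.evord x y hxy]
    refine hg.evord _ _ ?_
    simpa [Concurrent, hf.prec] using hxy

instance setoid (Sg : Type u) : Setoid (Iposet Sg) where
  r := Iso
  iseqv := ⟨Iso.refl, Iso.symm, Iso.trans⟩

/-- The discrete iposet on the loset `U` (a string of labels, listed in event order; its events are
the positions of the string), with source interface `S` and target interface `T`. -/
def discrete (U : List Sg) (S T : Set (Fin U.length)) : Iposet Sg where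
  carrier := Fin U.length
  finite := inferInstance
  prec _ _ := False
  evord i j := i < j
  label i := U.get i
  source := S
  target := T
  prec_irrefl _ h := h
  prec_trans _ _ _ h _ := h
  evord_irrefl i := lt_irrefl i
  evord_trans _ _ _ := lt_trans
  related _ _ h := Or.inr (Or.inr (lt_or_gt_of_ne h))
  source_minimal _ _ _ h := h
  target_maximal _ _ _ h := h
  interval := ⟨fun _ => 0, fun _ => 0, fun _ => le_rfl, fun _ _ => by simp⟩

/-- The word `w` as an iposet: its events are the positions of `w`, linearly ordered by precedence.
The first event is a source event iff `s = true`, the last one is a target event iff `t = true`. -/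
def word (w : List Sg) (s t : Bool) : Iposet Sg where
  carrier := Fin w.length
  finite := inferInstance
  prec i j := i < j
  evord _ _ := False
  label i := w.get i
  source := {i | s = true ∧ i.val = 0}
  target := {i | t = true ∧ i.val + 1 = w.length}
  prec_irrefl i := lt_irrefl i
  prec_trans _ _ _ := lt_trans
  evord_irrefl _ h := h
  evord_trans _ _ _ h _ := h
  related x y h := by rcases lt_or_gt_of_ne h with h | h <;> simp [h]
  source_minimal := by
    rintro x ⟨-, hx⟩ y hy
    have : y.val < x.val := hy
    omega
  target_maximal := by
    rintro x ⟨-, hx⟩ y hy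
    have : x.val < y.val := hy
    have := y.isLt
    omega
  interval := ⟨fun i => (i.val : ℝ), fun i => (i.val : ℝ), fun _ => le_rfl, fun x y => by
    rw [Nat.cast_lt]; rfl⟩

/-- An isomorphism of losets from the target interface of `P` to the source interface of `Q`. -/
structure Matching (P Q : Iposet Sg) where
  equiv : P.target ≃ Q.source
  label : ∀ t, Q.label (equiv t) = P.label t
  evord : ∀ s t, Q.evord (equiv s) (equiv t) ↔ P.evord s t

/-- The carrier of the gluing of `P` and `Q`: the disjoint union of `P` and `Q` in which each target
event of `P` is identified with the corresponding source event of `Q`; we represent the class of an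
identified pair by the event of `P`. -/
abbrev GlueCarrier (P Q : Iposet Sg) : Type := P.carrier ⊕ {q : Q.carrier // q ∉ Q.source}

namespace Matching

variable {P Q : Iposet Sg} (f : Matching P Q)

/-- The canonical map from `P` to the gluing. -/
def left (_ : Matching P Q) (p : P.carrier) : GlueCarrier P Q := Sum.inl p

open Classical in
/-- The canonical map from `Q` to the gluing. -/
noncomputable def right (q : Q.carrier) : GlueCarrier P Q :=
  if h : q ∈ Q.source then Sum.inl (f.equiv.symm ⟨q, h⟩).1 else Sum.inr ⟨q, h⟩

/-- Precedence in the gluing. -/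
def prec (x y : GlueCarrier P Q) : Prop :=
  (∃ p p', P.prec p p' ∧ f.left p = x ∧ f.left p' = y) ∨
  (∃ q q', Q.prec q q' ∧ f.right q = x ∧ f.right q' = y) ∨
  (∃ p q, p ∉ P.target ∧ q ∉ Q.source ∧ f.left p = x ∧ f.right q = y)

/-- The union of the event orders of `P` and `Q`. -/
def evordStep (x y : GlueCarrier P Q) : Prop :=
  (∃ p p', P.evord p p' ∧ f.left p = x ∧ f.left p' = y) ∨
  (∃ q q', Q.evord q q' ∧ f.right q = x ∧ f.right q' = y)

theorem right_source (q : Q.carrier) (h : q ∈ Q.source) :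
    f.right q = Sum.inl (f.equiv.symm ⟨q, h⟩).1 := by simp [right, h]

theorem right_not_source (q : Q.carrier) (h : q ∉ Q.source) :
    f.right q = Sum.inr ⟨q, h⟩ := by simp [right, h]

theorem right_equiv (t : P.target) : f.right (f.equiv t) = Sum.inl t.1 := by
  rw [right_source f _ (f.equiv t).2]; simp

theorem right_eq_inl {q : Q.carrier} {p : P.carrier} (h : f.right q = Sum.inl p) :
    ∃ hp : p ∈ P.target, q = f.equiv ⟨p, hp⟩ := by
  by_cases hq : q ∈ Q.source
  · rw [right_source f q hq] at h
    obtain rfl := Sum.inl.inj h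
    exact ⟨(f.equiv.symm ⟨q, hq⟩).2, by simp⟩
  · rw [right_not_source f q hq] at h
    cases h

theorem right_eq_inr {q : Q.carrier} {r} (h : f.right q = Sum.inr r) : q = r.1 := by
  by_cases hq : q ∈ Q.source
  · rw [right_source f q hq] at h
    cases h
  · rw [right_not_source f q hq] at h
    obtain rfl := Sum.inr.inj h
    rfl

theorem right_injective : Function.Injective f.right := by
  intro q q' h
  rcases hx : f.right q' with p | r
  · obtain ⟨hp, h1⟩ := f.right_eq_inl (h.trans hx)
    obtain ⟨hp', h2⟩ := f.right_eq_inl hx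
    rw [h1, h2]
  · rw [f.right_eq_inr (h.trans hx), f.right_eq_inr hx]

theorem prec_inl_inl (p p' : P.carrier) : f.prec (Sum.inl p) (Sum.inl p') ↔ P.prec p p' := by
  constructor
  · rintro (⟨x, y, h, hx, hy⟩ | ⟨x, y, h, hx, hy⟩ | ⟨x, y, h, h', hx, hy⟩)
    · cases hx; cases hy; exact h
    · obtain ⟨hp, rfl⟩ := f.right_eq_inl hy
      exact absurd h (Q.source_minimal _ (f.equiv _).2 _)
    · obtain ⟨hp, rfl⟩ := f.right_eq_inl hy
      exact absurd (f.equiv _).2 h'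
  · exact fun h => Or.inl ⟨p, p', h, rfl, rfl⟩

theorem prec_inl_inr_target (p : P.target) (q) :
    f.prec (Sum.inl p.1) (Sum.inr q) ↔ Q.prec (f.equiv p) q.1 := by
  constructor
  · rintro (⟨x, y, h, hx, hy⟩ | ⟨x, y, h, hx, hy⟩ | ⟨x, y, h, h', hx, hy⟩)
    · cases hy
    · obtain ⟨hp, rfl⟩ := f.right_eq_inl hx
      rw [f.right_eq_inr hy] at h
      exact h
    · cases hx; exact absurd p.2 h
  · exact fun h => Or.inr (Or.inl ⟨_, _, h, f.right_equiv p, f.right_not_source _ q.2⟩)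

theorem prec_inl_inr (p : P.carrier) (q) (hp : p ∉ P.target) :
    f.prec (Sum.inl p) (Sum.inr q) :=
  Or.inr (Or.inr ⟨p, q.1, hp, q.2, rfl, f.right_not_source _ q.2⟩)

theorem not_prec_inr_inl (q) (p : P.carrier) : ¬ f.prec (Sum.inr q) (Sum.inl p) := by
  rintro (⟨x, y, h, hx, hy⟩ | ⟨x, y, h, hx, hy⟩ | ⟨x, y, h, h', hx, hy⟩)
  · cases hx
  · obtain ⟨hp, rfl⟩ := f.right_eq_inl hy
    exact absurd h (Q.source_minimal _ (f.equiv _).2 _)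
  · cases hx

theorem prec_inr_inr (q q') : f.prec (Sum.inr q) (Sum.inr q') ↔ Q.prec q.1 q'.1 := by
  constructor
  · rintro (⟨x, y, h, hx, hy⟩ | ⟨x, y, h, hx, hy⟩ | ⟨x, y, h, h', hx, hy⟩)
    · cases hx
    · rw [f.right_eq_inr hx, f.right_eq_inr hy] at h
      exact h
    · cases hx
  · exact fun h => Or.inr (Or.inl ⟨_, _, h, f.right_not_source _ q.2, f.right_not_source _ q'.2⟩)

theorem interval : ∃ b e : GlueCarrier P Q → ℝ, (∀ x, b x ≤ e x) ∧
    ∀ x y, f.prec x y ↔ e x < b y := by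
  classical
  obtain ⟨b₁, e₁, h₁, hP⟩ := P.interval
  obtain ⟨b₂, e₂, h₂, hQ⟩ := Q.interval
  have := P.finite
  have := Q.finite
  obtain ⟨M, hM⟩ := (Set.finite_range e₁).bddAbove
  obtain ⟨m, hm⟩ := (Set.finite_range b₂).bddBelow
  have hM' : ∀ p, e₁ p ≤ M := fun p => hM ⟨p, rfl⟩
  have hm' : ∀ q, m ≤ b₂ q := fun q => hm ⟨q, rfl⟩
  refine ⟨Sum.elim b₁ (fun q => b₂ q.1 + (M + 1 - m)),
    Sum.elim (fun p => if h : p ∈ P.target then e₂ (f.equiv ⟨p, h⟩) + (M + 1 - m) else e₁ p)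
      (fun q => e₂ q.1 + (M + 1 - m)), ?_, ?_⟩
  · rintro (p | q)
    · by_cases hp : p ∈ P.target
      · simp only [Sum.elim_inl, hp, dite_true]
        linarith [h₁ p, hM' p, hm' (f.equiv ⟨p, hp⟩), h₂ (f.equiv ⟨p, hp⟩)]
      · simpa [hp] using h₁ p
    · simpa using h₂ q.1
  · rintro (p | q) (p' | q')
    · rw [prec_inl_inl]
      by_cases hp : p ∈ P.target
      · simp only [Sum.elim_inl, hp, dite_true]
        refine iff_of_false (P.target_maximal p hp p') ?_
        linarith [h₁ p', hM' p', hm' (f.equiv ⟨p, hp⟩), h₂ (f.equiv ⟨p, hp⟩)]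
      · simpa [hp] using hP p p'
    · by_cases hp : p ∈ P.target
      · rw [f.prec_inl_inr_target ⟨p, hp⟩, hQ]
        simp [hp]
      · refine iff_of_true (f.prec_inl_inr p q' hp) ?_
        simp only [Sum.elim_inl, Sum.elim_inr, hp, dite_false]
        linarith [hM' p, hm' q'.1]
    · refine iff_of_false (f.not_prec_inr_inl q p') ?_
      simp only [Sum.elim_inl, Sum.elim_inr]
      linarith [h₁ p', hM' p', hm' q.1, h₂ q.1]
    · rw [prec_inr_inr, hQ]
      simp

/-- The event orders of `P` and `Q` agree on identified events. -/
theorem evord_agree {p p' : P.carrier} {q q' : Q.carrier} (h : f.right q = f.left p)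
    (h' : f.right q' = f.left p') : Q.evord q q' ↔ P.evord p p' := by
  obtain ⟨hp, rfl⟩ := f.right_eq_inl h
  obtain ⟨hp', rfl⟩ := f.right_eq_inl h'
  exact f.evord ⟨p, hp⟩ ⟨p', hp'⟩

theorem not_transGen_evordStep (x : GlueCarrier P Q) : ¬ Relation.TransGen f.evordStep x x := by
  let A : GlueCarrier P Q → GlueCarrier P Q → Prop :=
    fun x y => ∃ p p', P.evord p p' ∧ f.left p = x ∧ f.left p' = y
  let B : GlueCarrier P Q → GlueCarrier P Q → Prop :=
    fun x y => ∃ q q', Q.evord q q' ∧ f.right q = x ∧ f.right q' = y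
  have hAA : ∀ x y z, A x y → A y z → A x z := by
    rintro _ _ _ ⟨p, p', h, rfl, rfl⟩ ⟨q, q', h', hq, rfl⟩
    cases hq
    exact ⟨p, q', P.evord_trans _ _ _ h h', rfl, rfl⟩
  have hBB : ∀ x y z, B x y → B y z → B x z := by
    rintro _ _ _ ⟨p, p', h, rfl, rfl⟩ ⟨q, q', h', hq, rfl⟩
    obtain rfl := f.right_injective hq
    exact ⟨p, q', Q.evord_trans _ _ _ h h', rfl, rfl⟩
  have hA : ∀ x, ¬ A x x := by
    rintro _ ⟨p, p', h, rfl, h'⟩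
    cases h'
    exact P.evord_irrefl _ h
  have hB : ∀ x, ¬ B x x := by
    rintro _ ⟨p, p', h, rfl, h'⟩
    obtain rfl := f.right_injective h'
    exact Q.evord_irrefl _ h
  have hABA : ∀ x y z w, A x y → B y z → A z w → A x w := by
    rintro _ _ _ _ ⟨p, p', h, rfl, rfl⟩ ⟨q, q', h', hq, rfl⟩ ⟨r, r', h'', hr, rfl⟩
    exact ⟨p, r', P.evord_trans _ _ _ (P.evord_trans _ _ _ h ((f.evord_agree hq hr.symm).1 h')) h'',
      rfl, rfl⟩
  have hBAB : ∀ x y z w, B x y → A y z → B z w → B x w := by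
    rintro _ _ _ _ ⟨q, q', h, rfl, rfl⟩ ⟨p, p', h', hp, rfl⟩ ⟨r, r', h'', hr, rfl⟩
    exact ⟨q, r', Q.evord_trans _ _ _ (Q.evord_trans _ _ _ h
      ((f.evord_agree hp.symm hr).2 h')) h'', rfl, rfl⟩
  have hAB : ∀ x y, A x y → B y x → False := by
    rintro _ _ ⟨p, p', h, rfl, rfl⟩ ⟨q, q', h', hq, hq'⟩
    exact P.evord_irrefl _ (P.evord_trans _ _ _ h ((f.evord_agree hq hq').1 h'))
  have key : ∀ x y, Relation.TransGen f.evordStep x y →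
      A x y ∨ B x y ∨ (∃ t, A x t ∧ B t y) ∨ (∃ t, B x t ∧ A t y) := by
    intro x y h
    induction h with
    | single h => rcases h with h | h
                  · exact Or.inl h
                  · exact Or.inr (Or.inl h)
    | @tail y z _ h ih =>
      have h : A y z ∨ B y z := h
      rcases ih with ih | ih | ⟨t, ih, ih'⟩ | ⟨t, ih, ih'⟩ <;> rcases h with h | h
      · exact Or.inl (hAA _ _ _ ih h)
      · exact Or.inr (Or.inr (Or.inl ⟨_, ih, h⟩))
      · exact Or.inr (Or.inr (Or.inr ⟨_, ih, h⟩))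
      · exact Or.inr (Or.inl (hBB _ _ _ ih h))
      · exact Or.inl (hABA _ _ _ _ ih ih' h)
      · exact Or.inr (Or.inr (Or.inl ⟨_, ih, hBB _ _ _ ih' h⟩))
      · exact Or.inr (Or.inr (Or.inr ⟨_, ih, hAA _ _ _ ih' h⟩))
      · exact Or.inr (Or.inl (hBAB _ _ _ _ ih ih' h))
  intro h
  rcases key x x h with h | h | ⟨t, h, h'⟩ | ⟨t, h, h'⟩
  · exact hA _ h
  · exact hB _ h
  · exact hAB _ _ h h'
  · exact hAB _ _ h' h

end Matching

/-- The gluing `P * Q` of two iposets along the isomorphism `f` from the target interface of `P` to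
the source interface of `Q`. -/
noncomputable def glue (P Q : Iposet Sg) (f : Matching P Q) : Iposet Sg where
  carrier := GlueCarrier P Q
  finite := by
    have := P.finite
    have := Q.finite
    infer_instance
  prec := f.prec
  evord := Relation.TransGen f.evordStep
  label := Sum.elim P.label (fun q => Q.label q.1)
  source := f.left '' P.source
  target := f.right '' Q.target
  prec_irrefl x h := by
    obtain ⟨b, e, h₁, h₂⟩ := f.interval
    linarith [h₁ x, (h₂ x x).1 h]
  prec_trans x y z h h' := by
    obtain ⟨b, e, h₁, h₂⟩ := f.interval
    rw [h₂] at h h' ⊢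
    linarith [h₁ y]
  evord_irrefl := f.not_transGen_evordStep
  evord_trans _ _ _ := Relation.TransGen.trans
  related := by
    have hl : ∀ p p', P.evord p p' →
        Relation.TransGen f.evordStep (Sum.inl p) (Sum.inl p') :=
      fun p p' h => .single (Or.inl ⟨p, p', h, rfl, rfl⟩)
    have hr : ∀ q q', Q.evord q q' →
        Relation.TransGen f.evordStep (f.right q) (f.right q') :=
      fun q q' h => .single (Or.inr ⟨q, q', h, rfl, rfl⟩)
    have hpr : ∀ q q', Q.prec q q' → f.prec (f.right q) (f.right q') :=
      fun q q' h => Or.inr (Or.inl ⟨q, q', h, rfl, rfl⟩)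
    have hQ : ∀ q q', f.right q ≠ f.right q' → f.prec (f.right q) (f.right q') ∨
        f.prec (f.right q') (f.right q) ∨
        Relation.TransGen f.evordStep (f.right q) (f.right q') ∨
        Relation.TransGen f.evordStep (f.right q') (f.right q) := by
      intro q q' h
      rcases Q.related q q' (fun h' => h (by rw [h'])) with h | h | h | h
      · exact Or.inl (hpr _ _ h)
      · exact Or.inr (Or.inl (hpr _ _ h))
      · exact Or.inr (Or.inr (Or.inl (hr _ _ h)))
      · exact Or.inr (Or.inr (Or.inr (hr _ _ h)))
    rintro (p | q) (p' | q') h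
    · rcases P.related p p' (fun h' => h (by rw [h'])) with h | h | h | h
      · exact Or.inl ((f.prec_inl_inl _ _).2 h)
      · exact Or.inr (Or.inl ((f.prec_inl_inl _ _).2 h))
      · exact Or.inr (Or.inr (Or.inl (hl _ _ h)))
      · exact Or.inr (Or.inr (Or.inr (hl _ _ h)))
    · by_cases hp : p ∈ P.target
      · have := hQ (f.equiv ⟨p, hp⟩) q'.1
        rw [f.right_equiv, f.right_not_source _ q'.2] at this
        exact this h
      · exact Or.inl (f.prec_inl_inr p q' hp)
    · by_cases hp : p' ∈ P.target
      · have := hQ q.1 (f.equiv ⟨p', hp⟩)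
        rw [f.right_equiv, f.right_not_source _ q.2] at this
        exact this h
      · exact Or.inr (Or.inl (f.prec_inl_inr p' q hp))
    · have := hQ q.1 q'.1
      rw [f.right_not_source _ q.2, f.right_not_source _ q'.2] at this
      exact this h
  source_minimal := by
    rintro _ ⟨p, hp, rfl⟩ (p' | q) h
    · exact P.source_minimal p hp p' ((f.prec_inl_inl _ _).1 h)
    · exact f.not_prec_inr_inl _ _ h
  target_maximal := by
    rintro _ ⟨q, hq, rfl⟩ y (⟨x, y, h, hx, hy⟩ | ⟨x, y, h, hx, hy⟩ | ⟨x, y, h, h', hx, hy⟩)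
    · obtain ⟨hp, -⟩ := f.right_eq_inl hx.symm
      exact P.target_maximal _ hp _ h
    · rw [f.right_injective hx] at h
      exact Q.target_maximal _ hq _ h
    · obtain ⟨hp, -⟩ := f.right_eq_inl hx.symm
      exact h hp
  interval := f.interval

end Iposet

/-- Ipomsets: isomorphism classes of iposets. -/
def Ipomset (Sg : Type u) : Type (max 1 u) := Quotient (Iposet.setoid Sg)

namespace Ipomset

variable {Sg : Type u}

/-- The isomorphism class of an iposet. -/
def mk (P : Iposet Sg) : Ipomset Sg := Quotient.mk (Iposet.setoid Sg) P

/-- The ipomset of a discrete iposet. -/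
def discrete (U : List Sg) (S T : Set (Fin U.length)) : Ipomset Sg := mk (Iposet.discrete U S T)

/-- The ipomset of a word, possibly with interfaces. -/
def word (w : List Sg) (s t : Bool) : Ipomset Sg := mk (Iposet.word w s t)

/-- The identity `id_U`. -/
def idt (U : List Sg) : Ipomset Sg := discrete U Set.univ Set.univ

/-- The starter which starts the events of `U` at the positions in `A`. -/
def starter (U : List Sg) (A : Finset ℕ) : Ipomset Sg := discrete U {i | i.val ∉ A} Set.univ

/-- The terminator which terminates the events of `U` at the positions in `A`. -/
def terminator (U : List Sg) (A : Finset ℕ) : Ipomset Sg := discrete U Set.univ {i | i.val ∉ A}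

/-- `Subsumed P Q` is `P ⊑ Q`: the ipomset `Q` subsumes `P`. -/
def Subsumed (P Q : Ipomset Sg) : Prop :=
  ∃ P' Q' : Iposet Sg, mk P' = P ∧ mk Q' = Q ∧ ∃ f, Iposet.IsSubsumption P' Q' f

/-- `Glues P Q R`: the gluing of the ipomsets `P` and `Q` is defined and `P * Q = R`. -/
def Glues (P Q R : Ipomset Sg) : Prop :=
  ∃ (P' Q' : Iposet Sg) (f : Iposet.Matching P' Q'),
    mk P' = P ∧ mk Q' = Q ∧ mk (P'.glue Q' f) = R

/-- The downward subsumption closure of a set of ipomsets. -/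
def down (L : Set (Ipomset Sg)) : Set (Ipomset Sg) := {P | ∃ Q ∈ L, Subsumed P Q}

/-- A language is a set of ipomsets closed under refinement. -/
def IsLanguage (L : Set (Ipomset Sg)) : Prop := ∀ P Q, Subsumed P Q → Q ∈ L → P ∈ L

/-- The prefix quotient `P \ L`. -/
def prefixQuotient (P : Ipomset Sg) (L : Set (Ipomset Sg)) : Set (Ipomset Sg) :=
  {Q | ∃ R ∈ L, Glues P Q R}

/-- Swap-invariance: `P * P' ∈ L`, `Q * Q' ∈ L` and `P ⊑ Q` imply `Q * P' ∈ L`. -/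
def SwapInvariant (L : Set (Ipomset Sg)) : Prop :=
  ∀ P Q P' Q' : Ipomset Sg, (∃ R ∈ L, Glues P P' R) → (∃ R ∈ L, Glues Q Q' R) → Subsumed P Q →
    ∃ R ∈ L, Glues Q P' R

end Ipomset

/-! ### Higher-dimensional automata -/

/-- The loset `U - A`: the string `U` with the positions in `A` removed. -/
def removeAt {Sg : Type u} (U : List Sg) (A : Finset ℕ) : List Sg :=
  (U.zipIdx.filter (fun p => p.2 ∉ A)).map Prod.fst

/-- The positions in `U - A` of the events which have the positions `B` (disjoint from `A`)
in `U`. -/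
def reindex (A B : Finset ℕ) : Finset ℕ := B.image (fun i => Nat.count (fun j => j ∉ A) i)

/-- Precubical sets over the alphabet `Sg`. Losets (up to isomorphism) are strings, and a set of
events of a loset `U` is a set of positions below `U.length`. The face map `face false A` is the
lower face map `δ⁰_A`, and `face true A` is the upper face map `δ¹_A`; both are only meaningful on
cells `x` with `A ⊆ ev x`, and no other value is ever used. -/
structure PrecubicalSet (Sg : Type u) where
  cell : Type v
  ev : cell → List Sg
  face : Bool → Finset ℕ → cell → cell
  ev_face : ∀ ν A x, A ⊆ Finset.range (ev x).length → ev (face ν A x) = removeAt (ev x) A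
  face_empty : ∀ ν x, face ν ∅ x = x
  face_union : ∀ ν A B x, A ⊆ Finset.range (ev x).length → B ⊆ Finset.range (ev x).length →
    Disjoint A B → face ν (reindex A B) (face ν A x) = face ν (A ∪ B) x
  face_comm : ∀ ν μ A B x, A ⊆ Finset.range (ev x).length → B ⊆ Finset.range (ev x).length →
    Disjoint A B →
      face μ (reindex A B) (face ν A x) = face ν (reindex B A) (face μ B x)

/-- Higher-dimensional automata. -/
structure HDA (Sg : Type u) extends PrecubicalSet.{u, v} Sg where
  start : Set cell
  accept : Set cell

namespace HDA

variable {Sg : Type u}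

/-- The set of (positions of) events of a cell. -/
def events (X : HDA.{u, v} Sg) (x : X.cell) : Finset ℕ := Finset.range (X.ev x).length

/-- Paths from `x`: sequences of upsteps and downsteps. -/
inductive Path (X : HDA.{u, v} Sg) (x : X.cell) : X.cell → Type (max u v)
  | nil : Path X x x
  /-- append an upstep, from `y = δ⁰_A z` to `z` -/
  | up {y : X.cell} (α : Path X x y) (z : X.cell) (A : Finset ℕ) (hA : A ⊆ X.events z)
      (h : X.face false A z = y) : Path X x z
  /-- append a downstep, from `y` to `z = δ¹_B y` -/
  | down {y : X.cell} (α : Path X x y) (z : X.cell) (B : Finset ℕ) (hB : B ⊆ X.events y)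
      (h : X.face true B y = z) : Path X x z

/-- `α.HasEvent P`: the event ipomset of the path `α` is `P`. It is the gluing of the starters and
terminators of the steps of `α`. -/
def Path.HasEvent {X : HDA.{u, v} Sg} {x : X.cell} :
    {y : X.cell} → Path X x y → Ipomset Sg → Prop
  | _, .nil, P => P = Ipomset.idt (X.ev x)
  | _, .up α z A _ _, P => ∃ Q, α.HasEvent Q ∧ Ipomset.Glues Q (Ipomset.starter (X.ev z) A) P
  | _, .down (y := y) α _ B _ _, P =>
      ∃ Q, α.HasEvent Q ∧ Ipomset.Glues Q (Ipomset.terminator (X.ev y) B) P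

/-- The language of an HDA: the event ipomsets of its accepting paths. -/
def lang (X : HDA.{u, v} Sg) : Set (Ipomset Sg) :=
  {P | ∃ x ∈ X.start, ∃ y ∈ X.accept, ∃ α : Path X x y, α.HasEvent P}

/-- Accessible cells. -/
def Accessible (X : HDA.{u, v} Sg) (y : X.cell) : Prop := ∃ x ∈ X.start, Nonempty (Path X x y)

/-- Coaccessible cells. -/
def Coaccessible (X : HDA.{u, v} Sg) (x : X.cell) : Prop := ∃ y ∈ X.accept, Nonempty (Path X x y)

/-- Essential cells. -/
def Essential (X : HDA.{u, v} Sg) (x : X.cell) : Prop := X.Accessible x ∧ X.Coaccessible x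

/-- Deterministic HDAs. -/
structure Deterministic (X : HDA.{u, v} Sg) : Prop where
  start_unique : ∀ U : List Sg, ∀ x ∈ X.start, ∀ y ∈ X.start, X.ev x = U → X.ev y = U → x = y
  up_unique : ∀ (V : List Sg) (A : Finset ℕ), A ⊆ Finset.range V.length →
    ∀ x, X.Essential x → X.ev x = removeAt V A →
      ∀ y z, X.ev y = V → X.ev z = V → X.Essential y → X.Essential z →
        X.face false A y = x → X.face false A z = x → y = z

end HDA

/-- Regular languages: languages of finite HDAs. -/
def IsRegularLanguage {Sg : Type u} (L : Set (Ipomset Sg)) : Prop :=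
  ∃ X : HDA.{u, 0} Sg, Finite X.cell ∧ X.lang = L

/-- Deterministic languages: languages of (possibly infinite) deterministic HDAs. -/
def IsDeterministicLanguage {Sg : Type u} (L : Set (Ipomset Sg)) : Prop :=
  ∃ X : HDA.{u, v} Sg, X.Deterministic ∧ X.lang = L

/-! Every ipomset that matters here has pairwise distinct labels (is simple), and such an ipomset is
determined by its profile: the sets of labels of all, source and target events, with precedence and
concurrent event order read as relations on labels (`Simple.ext`). Subsumption becomes inclusion of
relations, and gluing has an explicit description (`Glues.prec`, `Glues.conc`, `Glues.simple_iff`).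
Isomorphism classes and transitive closures thus disappear from the combinatorics. In particular, a
remainder of an element of the language after `a` and `b`, with only `b` still active, is `•b` or
`•bc`, and the second is possible only if `a` precedes `b` in the prefix (`remainder_cases`). This
gives both prefix quotients and the failure of swap-invariance.

For the failure of determinism, take any HDA with this language. An accepting path for `a ‖ b` has
to start in the initial vertex of a square `q` and end in its final vertex (`exists_square`), since
starting an event after another has been terminated would create a precedence. An accepting path for
`abc` has to run through edges `e`, `f`, `g` labelled `a`, `b`, `c` (`exists_three_edges`). In a
deterministic HDA the two start vertices coincide; then the lower `a`-edge of `q` is `e`, because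
both edges leave the same vertex; the precubical identities now put the upper `b`-edge of `q` at the
end of `e`, so this edge is `f`. Hence `g` leaves the final vertex of `q`, and passing through the
whole square and then through `g` is an accepting path. Its event ipomset has the events `a`, `b`,
`c`, but `a` does not precede `b`, so it is not in the language (`not_deterministic_of_lang_eq`).

Regularity comes from a finite HDA with two disjoint branches, a filled square for `a ‖ b` and a
chain of three edges for `abc` (`ParWord.hda`). An invariant of paths from start cells (`Reaches`)
shows that nothing else is accepted, and explicit paths give the four elements (`lang_hda`). -/

/-! ### Profiles: the label-level description of an ipomset -/

/-- The data of an iposet that are visible on the labels of its events: the labels of all events, of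
the source events and of the target events, precedence, and event order of concurrent events. -/
@[ext]
structure Profile (Sg : Type u) where
  events : Set Sg
  sources : Set Sg
  targets : Set Sg
  prec : Sg → Sg → Prop
  conc : Sg → Sg → Prop

namespace Iposet

variable {Sg : Type u}

/-- An iposet is simple if its events have pairwise distinct labels. -/
def Simple (P : Iposet Sg) : Prop := Function.Injective P.label

/-- The profile of an iposet. -/
def profile (P : Iposet Sg) : Profile Sg where
  events := Set.range P.label
  sources := P.label '' P.source
  targets := P.label '' P.target
  prec s t := ∃ x y, P.label x = s ∧ P.label y = t ∧ P.prec x y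
  conc s t := ∃ x y, P.label x = s ∧ P.label y = t ∧ P.Concurrent x y ∧ P.evord x y

theorem IsIso.concurrent {P Q : Iposet Sg} {f} (h : IsIso P Q f) (x y : P.carrier) :
    Q.Concurrent (f x) (f y) ↔ P.Concurrent x y := by
  simp [Concurrent, h.prec]

theorem IsIso.label_comp {P Q : Iposet Sg} {f} (h : IsIso P Q f) : Q.label ∘ f = P.label :=
  funext h.label

theorem Iso.simple {P Q : Iposet Sg} (h : Iso P Q) (hQ : Q.Simple) : P.Simple := by
  obtain ⟨f, hf⟩ := h
  rw [Simple, ← hf.label_comp]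
  exact Function.Injective.comp hQ hf.bijective.injective

theorem Iso.simple_iff {P Q : Iposet Sg} (h : Iso P Q) : P.Simple ↔ Q.Simple :=
  ⟨h.symm.simple, h.simple⟩

/-- The profile keeps event order only on concurrent pairs, since an isomorphism need not respect it
elsewhere. -/
theorem Iso.profile_eq {P Q : Iposet Sg} (h : Iso P Q) : P.profile = Q.profile := by
  obtain ⟨f, hf⟩ := h
  have hs := hf.bijective.surjective
  ext s
  · simp only [profile]
    rw [← hf.label_comp, hs.range_comp]
  · simp only [profile]
    rw [← hf.source, ← hf.label_comp, Set.image_comp]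
  · simp only [profile]
    rw [← hf.target, ← hf.label_comp, Set.image_comp]
  · simp only [profile, hs.exists, hf.label, hf.prec]
  · simp only [profile, hs.exists, hf.label, hf.concurrent]
    refine exists₂_congr fun x y => and_congr_right fun _ => and_congr_right fun _ =>
      and_congr_right fun h => hf.evord x y h

/-! ### Simple iposets are determined by their profiles. -/

section Simple

variable {P Q : Iposet Sg}

theorem Simple.profile_prec (h : P.Simple) (x y : P.carrier) :
    P.profile.prec (P.label x) (P.label y) ↔ P.prec x y := by
  constructor
  · rintro ⟨x', y', hx, hy, h'⟩
    rwa [← h hx, ← h hy]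
  · exact fun h' => ⟨x, y, rfl, rfl, h'⟩

theorem Simple.profile_conc (h : P.Simple) (x y : P.carrier) :
    P.profile.conc (P.label x) (P.label y) ↔ P.Concurrent x y ∧ P.evord x y := by
  constructor
  · rintro ⟨x', y', hx, hy, h'⟩
    rwa [← h hx, ← h hy]
  · exact fun h' => ⟨x, y, rfl, rfl, h'⟩

theorem Simple.label_mem_targets (h : P.Simple) (x : P.carrier) :
    P.label x ∈ P.profile.targets ↔ x ∈ P.target := h.mem_set_image

theorem Simple.label_mem_sources (h : P.Simple) (x : P.carrier) :
    P.label x ∈ P.profile.sources ↔ x ∈ P.source := h.mem_set_image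

theorem exists_bijective_of_events_eq (hP : P.Simple) (hQ : Q.Simple)
    (h : P.profile.events = Q.profile.events) :
    ∃ f : P.carrier → Q.carrier, Function.Bijective f ∧ ∀ x, Q.label (f x) = P.label x := by
  have h₁ : ∀ x, ∃ y, Q.label y = P.label x := fun x =>
    h.subset (Set.mem_range_self x)
  have h₂ : ∀ y, ∃ x, P.label x = Q.label y := fun y =>
    h.symm.subset (Set.mem_range_self y)
  choose f hf using h₁
  refine ⟨f, ⟨fun x y hxy => hP ?_, fun y => ?_⟩, hf⟩
  · rw [← hf, ← hf, hxy]
  · obtain ⟨x, hx⟩ := h₂ y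
    exact ⟨x, hQ (by rw [hf, hx])⟩

theorem image_eq_of_label_image_eq (hQ : Q.Simple) {f : P.carrier → Q.carrier}
    (hf : ∀ x, Q.label (f x) = P.label x) {A : Set P.carrier} {B : Set Q.carrier}
    (h : P.label '' A = Q.label '' B) : f '' A = B := by
  apply hQ.image_injective
  rw [← h, ← Set.image_comp]
  exact congrArg (· '' A) (funext hf)

/-- The only candidate map sends each event to the event with the same label, so the conditions on
events become conditions on labels. -/
theorem exists_isSubsumption (hP : P.Simple) (hQ : Q.Simple)
    (hE : P.profile.events = Q.profile.events) (hS : P.profile.sources = Q.profile.sources)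
    (hT : P.profile.targets = Q.profile.targets)
    (hprec : ∀ s t, Q.profile.prec s t → P.profile.prec s t)
    (hconc : ∀ s t, P.profile.conc s t → Q.profile.conc s t) : ∃ f, IsSubsumption P Q f := by
  obtain ⟨f, hb, hl⟩ := exists_bijective_of_events_eq hP hQ hE
  refine ⟨f, hb, image_eq_of_label_image_eq hQ hl hS, image_eq_of_label_image_eq hQ hl hT, hl,
    fun x y h => ?_, fun x y h h' => ?_⟩
  · rw [← hP.profile_prec]
    apply hprec
    rwa [← hl, ← hl, hQ.profile_prec]
  · have := hconc _ _ ((hP.profile_conc x y).2 ⟨h, h'⟩)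
    rw [← hl, ← hl, hQ.profile_conc] at this
    exact this.2

theorem iso_of_profile_eq (hP : P.Simple) (hQ : Q.Simple) (h : P.profile = Q.profile) :
    Iso P Q := by
  obtain ⟨f, hb, hl⟩ := exists_bijective_of_events_eq hP hQ (by rw [h])
  have hp : ∀ x y, P.prec x y ↔ Q.prec (f x) (f y) := fun x y => by
    rw [← hP.profile_prec, h, ← hl, ← hl, hQ.profile_prec]
  refine ⟨f, hb, image_eq_of_label_image_eq hQ hl (congrArg Profile.sources h),
    image_eq_of_label_image_eq hQ hl (congrArg Profile.targets h), hl, hp, fun x y hc => ?_⟩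
  have hc' : Q.Concurrent (f x) (f y) := by
    simpa only [Concurrent, hp] using hc
  have := hP.profile_conc x y
  rw [h, ← hl, ← hl, hQ.profile_conc] at this
  simpa [hc, hc'] using this.symm

end Simple

/-! ### Effect of a subsumption on profiles. -/

section Subsumption

variable {P Q : Iposet Sg} {f : P.carrier → Q.carrier}

theorem IsSubsumption.simple (h : IsSubsumption P Q f) (hQ : Q.Simple) : P.Simple := by
  intro x y hxy
  rw [← h.label, ← h.label] at hxy
  exact h.bijective.injective (hQ hxy)

theorem IsSubsumption.label_comp (h : IsSubsumption P Q f) : Q.label ∘ f = P.label :=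
  funext h.label

theorem IsSubsumption.events (h : IsSubsumption P Q f) :
    P.profile.events = Q.profile.events := by
  simp only [profile]
  rw [← h.label_comp, h.bijective.surjective.range_comp]

theorem IsSubsumption.sources (h : IsSubsumption P Q f) :
    P.profile.sources = Q.profile.sources := by
  simp only [profile]
  rw [← h.label_comp, Set.image_comp, h.source]

theorem IsSubsumption.targets (h : IsSubsumption P Q f) :
    P.profile.targets = Q.profile.targets := by
  simp only [profile]
  rw [← h.label_comp, Set.image_comp, h.target]

theorem IsSubsumption.profile_prec (h : IsSubsumption P Q f) (s t : Sg)
    (hst : Q.profile.prec s t) : P.profile.prec s t := by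
  obtain ⟨x, y, rfl, rfl, hxy⟩ := hst
  obtain ⟨x, rfl⟩ := h.bijective.surjective x
  obtain ⟨y, rfl⟩ := h.bijective.surjective y
  exact ⟨x, y, (h.label x).symm, (h.label y).symm, h.prec x y hxy⟩

theorem IsSubsumption.profile_conc (h : IsSubsumption P Q f) (s t : Sg)
    (hst : P.profile.conc s t) : Q.profile.conc s t := by
  obtain ⟨x, y, rfl, rfl, hxy, ho⟩ := hst
  exact ⟨f x, f y, h.label x, h.label y,
    ⟨fun hp => hxy.1 (h.prec _ _ hp), fun hp => hxy.2 (h.prec _ _ hp)⟩, h.evord x y hxy ho⟩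

end Subsumption

/-! ### Profiles of gluings. -/

section Glue

variable {P Q : Iposet Sg} (f : Matching P Q)

theorem label_glue_left (p : P.carrier) : (P.glue Q f).label (f.left p) = P.label p := rfl

theorem label_glue_right (q : Q.carrier) : (P.glue Q f).label (f.right q) = Q.label q := by
  by_cases hq : q ∈ Q.source
  · rw [f.right_source q hq]
    change P.label _ = _
    rw [← f.label, Equiv.apply_symm_apply]
  · rw [f.right_not_source q hq]
    rfl

theorem Matching.left_or_right (x : GlueCarrier P Q) :
    (∃ p, x = f.left p) ∨ ∃ q, q ∉ Q.source ∧ x = f.right q := by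
  rcases x with p | q
  · exact Or.inl ⟨p, rfl⟩
  · exact Or.inr ⟨q.1, q.2, (f.right_not_source _ q.2).symm⟩

theorem Matching.prec_right_right (q q' : Q.carrier) :
    f.prec (f.right q) (f.right q') ↔ Q.prec q q' := by
  constructor
  · rintro (⟨x, y, h, hx, hy⟩ | ⟨x, y, h, hx, hy⟩ | ⟨x, y, h, h', hx, hy⟩)
    · obtain ⟨hp, -⟩ := f.right_eq_inl hx.symm
      exact absurd h (P.target_maximal _ hp _)
    · rwa [← f.right_injective hx, ← f.right_injective hy]
    · obtain ⟨hp, -⟩ := f.right_eq_inl hx.symm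
      exact absurd hp h
  · exact fun h => Or.inr (Or.inl ⟨_, _, h, rfl, rfl⟩)

theorem glue_events : (P.glue Q f).profile.events = P.profile.events ∪ Q.profile.events := by
  ext s
  constructor
  · rintro ⟨x, rfl⟩
    rcases f.left_or_right x with ⟨p, rfl⟩ | ⟨q, -, rfl⟩
    · exact Or.inl ⟨p, rfl⟩
    · exact Or.inr ⟨q, (label_glue_right f q).symm⟩
  · rintro (⟨p, rfl⟩ | ⟨q, rfl⟩)
    · exact ⟨f.left p, rfl⟩
    · exact ⟨f.right q, label_glue_right f q⟩

theorem glue_sources : (P.glue Q f).profile.sources = P.profile.sources :=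
  (Set.image_comp (P.glue Q f).label f.left P.source).symm

theorem glue_targets : (P.glue Q f).profile.targets = Q.profile.targets := by
  refine (Set.image_comp (P.glue Q f).label f.right Q.target).symm.trans ?_
  exact congrArg (· '' Q.target) (funext (label_glue_right f))

theorem Matching.targets_eq_sources (f : Matching P Q) :
    P.profile.targets = Q.profile.sources := by
  ext s
  constructor
  · rintro ⟨p, hp, rfl⟩
    exact ⟨f.equiv ⟨p, hp⟩, (f.equiv ⟨p, hp⟩).2, f.label ⟨p, hp⟩⟩
  · rintro ⟨q, hq, rfl⟩
    refine ⟨f.equiv.symm ⟨q, hq⟩, (f.equiv.symm ⟨q, hq⟩).2, ?_⟩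
    rw [← f.label, Equiv.apply_symm_apply]

/-- A label occurring on both sides has to belong to an identified pair, that is, to a target event
of the first factor. -/
theorem glue_simple_iff : (P.glue Q f).Simple ↔
    P.Simple ∧ Q.Simple ∧ P.profile.events ∩ Q.profile.events ⊆ P.profile.targets := by
  constructor
  · refine fun h => ⟨fun p p' hp => ?_, fun q q' hq => ?_, ?_⟩
    · exact Sum.inl_injective (h (a₁ := f.left p) (a₂ := f.left p') hp)
    · refine f.right_injective (h ?_)
      rwa [label_glue_right, label_glue_right]
    · rintro _ ⟨⟨p, rfl⟩, ⟨q, hq⟩⟩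
      rw [← label_glue_right f, ← label_glue_left f] at hq
      exact ⟨p, (f.right_eq_inl (h hq)).1, rfl⟩
  · rintro ⟨hP, hQ, hPQ⟩
    have key : ∀ p q, q ∉ Q.source → P.label p ≠ Q.label q := by
      intro p q hq h
      have hp : P.label p ∈ P.profile.targets := hPQ ⟨⟨p, rfl⟩, ⟨q, h.symm⟩⟩
      rw [h, f.targets_eq_sources, hQ.label_mem_sources] at hp
      exact hq hp
    intro x y hxy
    rcases f.left_or_right x with ⟨p, rfl⟩ | ⟨q, hq, rfl⟩ <;>
      rcases f.left_or_right y with ⟨p', rfl⟩ | ⟨q', hq', rfl⟩ <;>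
      simp only [label_glue_right, label_glue_left] at hxy
    · rw [hP hxy]
    · exact absurd hxy (key _ _ hq')
    · exact absurd hxy.symm (key _ _ hq)
    · rw [hQ hxy]

/-- Simplicity of the factors lets "not a target event" and "not a source event" be tested on
labels. -/
theorem glue_prec (hP : P.Simple) (hQ : Q.Simple) (s t : Sg) :
    (P.glue Q f).profile.prec s t ↔ P.profile.prec s t ∨ Q.profile.prec s t ∨
      (s ∈ P.profile.events ∧ s ∉ P.profile.targets) ∧
        (t ∈ Q.profile.events ∧ t ∉ P.profile.targets) := by
  constructor
  · rintro ⟨_, _, rfl, rfl, ⟨x, y, h, rfl, rfl⟩ | ⟨x, y, h, rfl, rfl⟩ | ⟨x, y, h, h', rfl, rfl⟩⟩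
    · exact Or.inl ⟨x, y, rfl, rfl, h⟩
    · exact Or.inr (Or.inl ⟨x, y, (label_glue_right f x).symm, (label_glue_right f y).symm, h⟩)
    · rw [label_glue_right, label_glue_left, f.targets_eq_sources, hQ.label_mem_sources,
        ← f.targets_eq_sources, hP.label_mem_targets]
      exact Or.inr (Or.inr ⟨⟨⟨x, rfl⟩, h⟩, ⟨y, rfl⟩, h'⟩)
  · rintro (⟨x, y, rfl, rfl, h⟩ | ⟨x, y, rfl, rfl, h⟩ | ⟨⟨⟨x, rfl⟩, h⟩, ⟨y, rfl⟩, h'⟩)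
    · exact ⟨f.left x, f.left y, rfl, rfl, Or.inl ⟨x, y, h, rfl, rfl⟩⟩
    · exact ⟨f.right x, f.right y, label_glue_right f x, label_glue_right f y,
        Or.inr (Or.inl ⟨x, y, h, rfl, rfl⟩)⟩
    · rw [hP.label_mem_targets] at h
      rw [f.targets_eq_sources, hQ.label_mem_sources] at h'
      exact ⟨f.left x, f.right y, rfl, label_glue_right f y, Or.inr (Or.inr ⟨x, y, h, h', rfl, rfl⟩)⟩

/-- Taking the transitive closure adds nothing on concurrent pairs. Such a pair lies within one
factor, because a non-target event of `P` precedes every non-source event of `Q`. There the two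
events are already related by event order, and the reverse direction would contradict irreflexivity
in the gluing. No simplicity is needed. -/
theorem glue_conc (s t : Sg) :
    (P.glue Q f).profile.conc s t ↔ P.profile.conc s t ∨ Q.profile.conc s t := by
  have hasymm : ∀ x y, (P.glue Q f).evord x y → ¬ (P.glue Q f).evord y x := fun x y h h' =>
    (P.glue Q f).evord_irrefl x ((P.glue Q f).evord_trans _ _ _ h h')
  have hl : ∀ p p', P.evord p p' → (P.glue Q f).evord (f.left p) (f.left p') :=
    fun p p' h => .single (Or.inl ⟨p, p', h, rfl, rfl⟩)
  have hr : ∀ q q', Q.evord q q' → (P.glue Q f).evord (f.right q) (f.right q') :=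
    fun q q' h => .single (Or.inr ⟨q, q', h, rfl, rfl⟩)
  have hlc : ∀ p p', (P.glue Q f).Concurrent (f.left p) (f.left p') ↔ P.Concurrent p p' :=
    fun p p' => and_congr (not_congr (f.prec_inl_inl p p')) (not_congr (f.prec_inl_inl p' p))
  have hrc : ∀ q q', (P.glue Q f).Concurrent (f.right q) (f.right q') ↔ Q.Concurrent q q' :=
    fun q q' => and_congr (not_congr (f.prec_right_right q q'))
      (not_congr (f.prec_right_right q' q))
  have hR : ∀ q q', (P.glue Q f).Concurrent (f.right q) (f.right q') →
      (P.glue Q f).evord (f.right q) (f.right q') → Q.profile.conc (Q.label q) (Q.label q') := by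
    intro q q' hc ho
    have hne : q ≠ q' := by
      rintro rfl
      exact (P.glue Q f).evord_irrefl _ ho
    rw [hrc] at hc
    rcases Q.related q q' hne with h | h | h | h
    · exact absurd h hc.1
    · exact absurd h hc.2
    · exact ⟨q, q', rfl, rfl, hc, h⟩
    · exact absurd (hr _ _ h) (hasymm _ _ ho)
  constructor
  · rintro ⟨x, y, rfl, rfl, hc, ho⟩
    rcases x with p | q <;> rcases y with p' | q'
    · left
      have hne : p ≠ p' := by
        rintro rfl
        exact (P.glue Q f).evord_irrefl _ ho
      have hc := (hlc p p').1 hc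
      rcases P.related p p' hne with h | h | h | h
      · exact absurd h hc.1
      · exact absurd h hc.2
      · exact ⟨p, p', rfl, rfl, hc, h⟩
      · exact absurd (hl _ _ h) (hasymm _ _ ho)
    · right
      have hp : p ∈ P.target := by
        by_contra hp
        exact hc.1 (f.prec_inl_inr p q' hp)
      have h := hR (f.equiv ⟨p, hp⟩) q'.1
      rw [← label_glue_right f, ← label_glue_right f, f.right_equiv,
        f.right_not_source _ q'.2] at h
      exact h hc ho
    · right
      have hp : p' ∈ P.target := by
        by_contra hp
        exact hc.2 (f.prec_inl_inr p' q hp)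
      have h := hR q.1 (f.equiv ⟨p', hp⟩)
      rw [← label_glue_right f, ← label_glue_right f, f.right_equiv,
        f.right_not_source _ q.2] at h
      exact h hc ho
    · right
      have h := hR q.1 q'.1
      rw [← label_glue_right f, ← label_glue_right f, f.right_not_source _ q.2,
        f.right_not_source _ q'.2] at h
      exact h hc ho
  · rintro (⟨x, y, rfl, rfl, hc, ho⟩ | ⟨x, y, rfl, rfl, hc, ho⟩)
    · exact ⟨f.left x, f.left y, rfl, rfl, (hlc x y).2 hc, hl _ _ ho⟩
    · exact ⟨f.right x, f.right y, label_glue_right f x, label_glue_right f y, (hrc x y).2 hc,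
        hr _ _ ho⟩

theorem concurrent_of_target {x y : P.carrier} (hx : x ∈ P.target) (hy : y ∈ P.target) :
    P.Concurrent x y := ⟨P.target_maximal x hx y, P.target_maximal y hy x⟩

theorem concurrent_of_source {x y : P.carrier} (hx : x ∈ P.source) (hy : y ∈ P.source) :
    P.Concurrent x y := ⟨P.source_minimal y hy x, P.source_minimal x hx y⟩

/-- Interfaces are matched by label. Target events are maximal and source events minimal, so events
within an interface are concurrent and `conc` records the whole event order there. -/
theorem exists_matching (hP : P.Simple) (hQ : Q.Simple)
    (h : P.profile.targets = Q.profile.sources)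
    (hc : ∀ s ∈ P.profile.targets, ∀ t ∈ P.profile.targets,
      (Q.profile.conc s t ↔ P.profile.conc s t)) : Nonempty (Matching P Q) := by
  have h₁ : ∀ x : P.target, ∃ y : Q.source, Q.label y = P.label x := by
    rintro ⟨x, hx⟩
    have : P.label x ∈ Q.profile.sources := h ▸ ⟨x, hx, rfl⟩
    obtain ⟨y, hy, hxy⟩ := this
    exact ⟨⟨y, hy⟩, hxy⟩
  choose g hg using h₁
  have hb : Function.Bijective g := by
    constructor
    · intro x y hxy
      apply Subtype.ext
      apply hP
      rw [← hg, ← hg, hxy]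
    · rintro ⟨y, hy⟩
      have : Q.label y ∈ P.profile.targets := h ▸ ⟨y, hy, rfl⟩
      obtain ⟨x, hx, hxy⟩ := this
      exact ⟨⟨x, hx⟩, Subtype.ext (hQ (by rw [hg, hxy]))⟩
  refine ⟨⟨Equiv.ofBijective g hb, hg, fun s t => ?_⟩⟩
  have := hc _ ⟨s, s.2, rfl⟩ _ ⟨t, t.2, rfl⟩
  rw [hP.profile_conc, ← hg, ← hg, hQ.profile_conc] at this
  simpa [concurrent_of_source (g s).2 (g t).2, concurrent_of_target s.2 t.2] using this

end Glue

end Iposet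

/-! ### Profiles of isomorphism classes. -/

namespace Ipomset

variable {Sg : Type u}

/-- An ipomset is simple if its events have pairwise distinct labels. -/
def Simple (P : Ipomset Sg) : Prop :=
  Quotient.lift Iposet.Simple (fun _ _ h => propext (Iposet.Iso.simple_iff h)) P

/-- The profile of an ipomset. -/
def profile (P : Ipomset Sg) : Profile Sg :=
  Quotient.lift Iposet.profile (fun _ _ h => Iposet.Iso.profile_eq h) P

/-- This reduces identities of ipomsets to label-by-label checks. -/
theorem Simple.ext {P Q : Ipomset Sg} (hP : P.Simple) (hQ : Q.Simple)
    (h : P.profile = Q.profile) : P = Q := by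
  induction P using Quotient.inductionOn
  induction Q using Quotient.inductionOn
  exact Quotient.sound (Iposet.iso_of_profile_eq hP hQ h)

/-! ### Properties of profiles -/

section Properties

variable {P : Ipomset Sg} {s t r : Sg}

theorem sources_subset (P : Ipomset Sg) : P.profile.sources ⊆ P.profile.events := by
  induction P using Quotient.inductionOn
  exact Set.image_subset_range _ _

theorem targets_subset (P : Ipomset Sg) : P.profile.targets ⊆ P.profile.events := by
  induction P using Quotient.inductionOn
  exact Set.image_subset_range _ _

theorem mem_events_of_prec (h : P.profile.prec s t) :
    s ∈ P.profile.events ∧ t ∈ P.profile.events := by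
  induction P using Quotient.inductionOn
  obtain ⟨x, y, rfl, rfl, -⟩ := h
  exact ⟨⟨x, rfl⟩, ⟨y, rfl⟩⟩

theorem mem_events_of_conc (h : P.profile.conc s t) :
    s ∈ P.profile.events ∧ t ∈ P.profile.events := by
  induction P using Quotient.inductionOn
  obtain ⟨x, y, rfl, rfl, -⟩ := h
  exact ⟨⟨x, rfl⟩, ⟨y, rfl⟩⟩

theorem Simple.prec_irrefl (hP : P.Simple) : ¬ P.profile.prec s s := by
  induction P using Quotient.inductionOn with
  | h P =>
    rintro ⟨x, y, rfl, h, h'⟩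
    rw [hP h] at h'
    exact P.prec_irrefl _ h'

theorem Simple.prec_asymm (hP : P.Simple) (h : P.profile.prec s t) : ¬ P.profile.prec t s := by
  induction P using Quotient.inductionOn with
  | h P =>
    obtain ⟨x, y, rfl, rfl, h⟩ := h
    intro h'
    exact P.prec_irrefl _ (P.prec_trans _ _ _ h ((hP.profile_prec y x).1 h'))

theorem Simple.conc_asymm (hP : P.Simple) (h : P.profile.conc s t) : ¬ P.profile.conc t s := by
  induction P using Quotient.inductionOn with
  | h P =>
    obtain ⟨x, y, rfl, rfl, -, h⟩ := h
    intro h'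
    exact P.evord_irrefl _ (P.evord_trans _ _ _ h ((hP.profile_conc y x).1 h').2)

theorem Simple.conc_irrefl (hP : P.Simple) : ¬ P.profile.conc s s := fun h => hP.conc_asymm h h

theorem Simple.not_prec_of_conc (hP : P.Simple) (h : P.profile.conc s t) :
    ¬ P.profile.prec s t ∧ ¬ P.profile.prec t s := by
  induction P using Quotient.inductionOn with
  | h P =>
    obtain ⟨x, y, rfl, rfl, h, -⟩ := h
    exact ⟨fun h' => h.1 ((hP.profile_prec x y).1 h'), fun h' => h.2 ((hP.profile_prec y x).1 h')⟩

theorem Simple.related (hP : P.Simple) (hs : s ∈ P.profile.events) (ht : t ∈ P.profile.events)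
    (h : s ≠ t) : P.profile.prec s t ∨ P.profile.prec t s ∨ P.profile.conc s t ∨
      P.profile.conc t s := by
  induction P using Quotient.inductionOn with
  | h P =>
    obtain ⟨x, rfl⟩ := hs
    obtain ⟨y, rfl⟩ := ht
    have hp := hP.profile_prec
    have hc := hP.profile_conc
    change P.profile.prec _ _ ∨ P.profile.prec _ _ ∨ P.profile.conc _ _ ∨ P.profile.conc _ _
    rw [hp, hp, hc, hc]
    have := P.related x y (fun h' => h (by rw [h']))
    unfold Iposet.Concurrent
    tauto

theorem Simple.target_maximal (hP : P.Simple) (hs : s ∈ P.profile.targets) :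
    ¬ P.profile.prec s t := by
  induction P using Quotient.inductionOn with
  | h P =>
    obtain ⟨x, hx, rfl⟩ := hs
    rintro ⟨x', y, h, rfl, h'⟩
    rw [hP h] at h'
    exact P.target_maximal x hx y h'

end Properties

/-! ### Subsumption and gluing in terms of profiles -/

theorem Subsumed.profile {P Q : Ipomset Sg} (h : Subsumed P Q) (hQ : Q.Simple) :
    P.Simple ∧ P.profile.events = Q.profile.events ∧ P.profile.sources = Q.profile.sources ∧
      P.profile.targets = Q.profile.targets ∧ (∀ s t, Q.profile.prec s t → P.profile.prec s t) ∧
      ∀ s t, P.profile.conc s t → Q.profile.conc s t := by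
  obtain ⟨P, Q, rfl, rfl, f, h⟩ := h
  exact ⟨h.simple hQ, h.events, h.sources, h.targets, h.profile_prec, h.profile_conc⟩

theorem Simple.subsumed {P Q : Ipomset Sg} (hP : P.Simple) (hQ : Q.Simple)
    (hE : P.profile.events = Q.profile.events) (hS : P.profile.sources = Q.profile.sources)
    (hT : P.profile.targets = Q.profile.targets)
    (hprec : ∀ s t, Q.profile.prec s t → P.profile.prec s t)
    (hconc : ∀ s t, P.profile.conc s t → Q.profile.conc s t) : Subsumed P Q := by
  induction P using Quotient.inductionOn with
  | h P =>
  induction Q using Quotient.inductionOn with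
  | h Q => exact ⟨P, Q, rfl, rfl, Iposet.exists_isSubsumption hP hQ hE hS hT hprec hconc⟩

theorem Simple.subsumed_refl {P : Ipomset Sg} (hP : P.Simple) : Subsumed P P :=
  hP.subsumed hP rfl rfl rfl (fun _ _ => id) (fun _ _ => id)

section Glues

variable {P Q R : Ipomset Sg}

theorem Glues.simple_iff (h : Glues P Q R) : R.Simple ↔
    P.Simple ∧ Q.Simple ∧ P.profile.events ∩ Q.profile.events ⊆ P.profile.targets := by
  obtain ⟨P, Q, f, rfl, rfl, rfl⟩ := h
  exact Iposet.glue_simple_iff f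

theorem Glues.events (h : Glues P Q R) :
    R.profile.events = P.profile.events ∪ Q.profile.events := by
  obtain ⟨P, Q, f, rfl, rfl, rfl⟩ := h
  exact Iposet.glue_events f

theorem Glues.sources (h : Glues P Q R) : R.profile.sources = P.profile.sources := by
  obtain ⟨P, Q, f, rfl, rfl, rfl⟩ := h
  exact Iposet.glue_sources f

theorem Glues.targets (h : Glues P Q R) : R.profile.targets = Q.profile.targets := by
  obtain ⟨P, Q, f, rfl, rfl, rfl⟩ := h
  exact Iposet.glue_targets f

theorem Glues.targets_eq_sources (h : Glues P Q R) :
    P.profile.targets = Q.profile.sources := by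
  obtain ⟨P, Q, f, rfl, rfl, rfl⟩ := h
  exact f.targets_eq_sources

theorem Glues.prec (h : Glues P Q R) (hP : P.Simple) (hQ : Q.Simple) (s t : Sg) :
    R.profile.prec s t ↔ P.profile.prec s t ∨ Q.profile.prec s t ∨
      (s ∈ P.profile.events ∧ s ∉ P.profile.targets) ∧
        (t ∈ Q.profile.events ∧ t ∉ P.profile.targets) := by
  obtain ⟨P, Q, f, rfl, rfl, rfl⟩ := h
  exact Iposet.glue_prec f hP hQ s t

theorem Glues.conc (h : Glues P Q R) (s t : Sg) :
    R.profile.conc s t ↔ P.profile.conc s t ∨ Q.profile.conc s t := by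
  obtain ⟨P, Q, f, rfl, rfl, rfl⟩ := h
  exact Iposet.glue_conc f s t

theorem Simple.exists_glues (hP : P.Simple) (hQ : Q.Simple)
    (h : P.profile.targets = Q.profile.sources)
    (hc : ∀ s ∈ P.profile.targets, ∀ t ∈ P.profile.targets,
      (Q.profile.conc s t ↔ P.profile.conc s t)) : ∃ R, Glues P Q R := by
  induction P using Quotient.inductionOn with
  | h P =>
  induction Q using Quotient.inductionOn with
  | h Q =>
    obtain ⟨f⟩ := Iposet.exists_matching hP hQ h hc
    exact ⟨mk (P.glue Q f), P, Q, f, rfl, rfl, rfl⟩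

end Glues

/-! ### Profiles of losets and words -/

theorem discrete_simple {U : List Sg} (hU : U.Nodup) (S T) : (discrete U S T).Simple :=
  List.nodup_iff_injective_get.1 hU

theorem simple_discrete_iff {U : List Sg} {S T} : (discrete U S T).Simple ↔ U.Nodup :=
  List.nodup_iff_injective_get.symm

theorem word_simple {w : List Sg} (hw : w.Nodup) (s t) : (word w s t).Simple :=
  List.nodup_iff_injective_get.1 hw

theorem discrete_events (U : List Sg) (S T) : (discrete U S T).profile.events = {s | s ∈ U} :=
  Set.range_list_get U

theorem word_events (w : List Sg) (s t) : (word w s t).profile.events = {s | s ∈ w} :=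
  Set.range_list_get w

theorem not_discrete_prec (U : List Sg) (S T) (s t) :
    ¬ (discrete U S T).profile.prec s t := by
  rintro ⟨_, _, -, -, h⟩
  exact h

theorem not_word_conc (w : List Sg) (b b') (s t) : ¬ (word w b b').profile.conc s t := by
  rintro ⟨_, _, -, -, -, h⟩
  exact h

theorem discrete_conc (U : List Sg) (S T) (s t) :
    (discrete U S T).profile.conc s t ↔ ∃ i j : Fin U.length, i < j ∧ U.get i = s ∧ U.get j = t :=
  ⟨fun ⟨i, j, hi, hj, _, h⟩ => ⟨i, j, h, hi, hj⟩,
    fun ⟨i, j, h, hi, hj⟩ => ⟨i, j, hi, hj, ⟨id, id⟩, h⟩⟩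

theorem word_prec (w : List Sg) (b b') (s t) :
    (word w b b').profile.prec s t ↔ ∃ i j : Fin w.length, i < j ∧ w.get i = s ∧ w.get j = t :=
  ⟨fun ⟨i, j, hi, hj, h⟩ => ⟨i, j, h, hi, hj⟩, fun ⟨i, j, h, hi, hj⟩ => ⟨i, j, hi, hj, h⟩⟩

theorem discrete_sources (U : List Sg) (S T) : (discrete U S T).profile.sources = U.get '' S := rfl

theorem discrete_targets (U : List Sg) (S T) : (discrete U S T).profile.targets = U.get '' T := rfl

theorem word_sources (w : List Sg) (b b') :
    (word w b b').profile.sources = w.get '' {i | b = true ∧ i.val = 0} := rfl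

theorem word_targets (w : List Sg) (b b') :
    (word w b b').profile.targets = w.get '' {i | b' = true ∧ i.val + 1 = w.length} := rfl

end Ipomset
-- Explicit profiles of short words and of a pair of concurrent events.
namespace Ipomset
variable {Sg : Type u}

theorem exists_lt_get_nil (s t : Sg) :
    ¬ ∃ i j : Fin ([] : List Sg).length,
      i < j ∧ ([] : List Sg).get i = s ∧ ([] : List Sg).get j = t := by
  rintro ⟨i, -⟩
  exact i.elim0

theorem exists_lt_get_cons (x : Sg) (U : List Sg) (s t : Sg) :
    (∃ i j : Fin (x :: U).length, i < j ∧ (x :: U).get i = s ∧ (x :: U).get j = t) ↔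
      (s = x ∧ t ∈ U) ∨ ∃ i j : Fin U.length, i < j ∧ U.get i = s ∧ U.get j = t := by
  have : ∀ p : Fin (x :: U).length → Prop,
      (∃ i, p i) ↔ p (0 : Fin (U.length + 1)) ∨ ∃ i : Fin U.length, p i.succ :=
    fun p => Fin.exists_fin_succ
  simp only [this]
  simp [List.mem_iff_get, eq_comm]

theorem profile_pair (a b : Sg) (S T) : (discrete [a, b] S T).profile =
    ⟨{a, b}, [a, b].get '' S, [a, b].get '' T, fun _ _ => False, fun s t => s = a ∧ t = b⟩ := by
  ext s t
  · simp [discrete_events]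
  · rfl
  · rfl
  · simp [not_discrete_prec]
  · simp only [discrete_conc, exists_lt_get_cons, exists_lt_get_nil]
    simp

theorem profile_word₁ (a : Sg) (b' : Bool) : (word [a] b' false).profile =
    ⟨{a}, {s | b' = true ∧ s = a}, ∅, fun _ _ => False, fun _ _ => False⟩ := by
  ext s t
  · simp [word_events]
  · simp [word_sources, eq_comm]
  · simp [word_targets]
  · simp only [word_prec, exists_lt_get_cons, exists_lt_get_nil]
    simp
  · simp [not_word_conc]

theorem profile_word₂ (a b : Sg) (s t : Bool) : (word [a, b] s t).profile =
    ⟨{a, b}, {r | s = true ∧ r = a}, {r | t = true ∧ r = b}, fun s t => s = a ∧ t = b,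
      fun _ _ => False⟩ := by
  ext r r'
  · simp [word_events]
  · simp [word_sources, Fin.exists_fin_succ, eq_comm]
  · simp [word_targets, Fin.exists_fin_succ, eq_comm]
  · simp only [word_prec, exists_lt_get_cons, exists_lt_get_nil]
    simp
  · simp [not_word_conc]

theorem profile_word₃ (a b c : Sg) : (word [a, b, c] false false).profile =
    ⟨{a, b, c}, ∅, ∅, fun s t => s = a ∧ (t = b ∨ t = c) ∨ s = b ∧ t = c, fun _ _ => False⟩ := by
  ext r r'
  · simp [word_events]
  · simp [word_sources]
  · simp [word_targets]
  · simp only [word_prec, exists_lt_get_cons, exists_lt_get_nil]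
    simp
  · simp [not_word_conc]

/-! ### The language `{a ‖ b, ab, ba, abc}` -/

/-- The language `{a ‖ b, ab, ba, abc}`. -/
def parWordLang (a b c : Sg) : Set (Ipomset Sg) :=
  {discrete [a, b] ∅ ∅, word [a, b] false false, word [b, a] false false,
    word [a, b, c] false false}

variable {a b c : Sg}

/-- The three precedences relate every pair of events, so asymmetry excludes further precedences and
nothing is left to be concurrent. -/
theorem eq_word₃ (hab : a ≠ b) (hac : a ≠ c) (hbc : b ≠ c) {P : Ipomset Sg} (hP : P.Simple)
    (hE : P.profile.events = {a, b, c}) (hS : P.profile.sources = ∅)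
    (hT : P.profile.targets = ∅) (h₁ : P.profile.prec a b) (h₂ : P.profile.prec a c)
    (h₃ : P.profile.prec b c) : P = word [a, b, c] false false := by
  refine hP.ext (word_simple (by simp [*]) _ _) ?_
  rw [profile_word₃]
  have hmem : ∀ r, r ∈ P.profile.events ↔ r = a ∨ r = b ∨ r = c := by simp [hE]
  have hi := fun s => hP.prec_irrefl (s := s)
  have ha := fun s t => hP.prec_asymm (s := s) (t := t)
  have hci := fun s => hP.conc_irrefl (s := s)
  have hcp := fun s t => hP.not_prec_of_conc (s := s) (t := t)
  ext r r'
  · simp [hE]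
  · simp [hS]
  · simp [hT]
  · have := mem_events_of_prec (P := P) (s := r) (t := r')
    grind
  · have := mem_events_of_conc (P := P) (s := r) (t := r')
    grind

/-- Two distinct events are related in one of four ways; `h` excludes `b` before `a` in event order,
and the other three give `ab`, `ba` and `a ‖ b`. -/
theorem mem_parWordLang_of_events_eq_pair (hab : a ≠ b) {P : Ipomset Sg} (hP : P.Simple)
    (hE : P.profile.events = {a, b}) (hS : P.profile.sources = ∅)
    (hT : P.profile.targets = ∅) (h : ∀ s t, P.profile.conc s t → s = a ∧ t = b) :
    P ∈ parWordLang a b c := by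
  have hmem : ∀ r, r ∈ P.profile.events ↔ r = a ∨ r = b := by simp [hE]
  have hi := fun s => hP.prec_irrefl (s := s)
  have ha := fun s t => hP.prec_asymm (s := s) (t := t)
  have hcp := fun s t => hP.not_prec_of_conc (s := s) (t := t)
  have hp := fun s t => mem_events_of_prec (P := P) (s := s) (t := t)
  rcases hP.related ((hmem a).2 (Or.inl rfl)) ((hmem b).2 (Or.inr rfl)) hab with hr | hr | hr | hr
  · refine Or.inr (Or.inl (hP.ext (word_simple (by simp [hab]) _ _) ?_))
    rw [profile_word₂]
    ext r r' <;> grind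
  · refine Or.inr (Or.inr (Or.inl (hP.ext (word_simple (by simp [hab.symm]) _ _) ?_)))
    rw [profile_word₂]
    ext r r' <;> grind
  · refine Or.inl (hP.ext (discrete_simple (by simp [hab]) _ _) ?_)
    rw [profile_pair]
    ext r r' <;> simp <;> grind
  · exact absurd (h _ _ hr).1 hab.symm

theorem simple_of_mem_parWordLang (hab : a ≠ b) (hac : a ≠ c) (hbc : b ≠ c) {P : Ipomset Sg}
    (hP : P ∈ parWordLang a b c) : P.Simple := by
  rcases hP with rfl | rfl | rfl | rfl
  · exact discrete_simple (by simp [hab]) _ _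
  · exact word_simple (by simp [hab]) _ _
  · exact word_simple (by simp [hab.symm]) _ _
  · exact word_simple (by simp [*]) _ _

/-- The case split follows the two generators of the language: the first alternative covers `a ‖ b`,
`ab` and `ba`, the second `abc`. -/
theorem profile_of_mem_parWordLang {P : Ipomset Sg} (hP : P ∈ parWordLang a b c) :
    (P.profile.sources = ∅ ∧ P.profile.targets = ∅) ∧
    ((P.profile.events = {a, b} ∧ ∀ s t, P.profile.conc s t → s = a ∧ t = b) ∨
      (P.profile.events = {a, b, c} ∧ P.profile.prec a b ∧ P.profile.prec a c ∧
        P.profile.prec b c)) := by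
  rcases hP with rfl | rfl | rfl | rfl
  · simp [profile_pair]
  · simp [profile_word₂]
  · simp [profile_word₂, Set.pair_comm]
  · simp [profile_word₃]

/-- Refinement only adds precedence and removes concurrency. Both alternatives of
`profile_of_mem_parWordLang` are stable under this, and each of them implies membership. -/
theorem isLanguage_parWordLang (hab : a ≠ b) (hac : a ≠ c) (hbc : b ≠ c) :
    IsLanguage (parWordLang a b c) := by
  intro P Q hPQ hQ
  obtain ⟨hP, hE, hS, hT, hp, hc⟩ := hPQ.profile (simple_of_mem_parWordLang hab hac hbc hQ)
  obtain ⟨⟨hS', hT'⟩, ⟨hE', h⟩ | ⟨hE', h₁, h₂, h₃⟩⟩ := profile_of_mem_parWordLang hQ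
  · exact mem_parWordLang_of_events_eq_pair hab hP (hE.trans hE') (hS.trans hS') (hT.trans hT')
      fun s t hst => h s t (hc s t hst)
  · exact Or.inr (Or.inr (Or.inr (eq_word₃ hab hac hbc hP (hE.trans hE') (hS.trans hS')
      (hT.trans hT') (hp _ _ h₁) (hp _ _ h₂) (hp _ _ h₃))))

theorem down_eq_parWordLang (hab : a ≠ b) (hac : a ≠ c) (hbc : b ≠ c) :
    down {discrete [a, b] ∅ ∅, word [a, b, c] false false} = parWordLang a b c := by
  have hd := discrete_simple (U := [a, b]) (by simp [hab]) ∅ ∅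
  ext P
  constructor
  · rintro ⟨Q, hQ, hPQ⟩
    refine isLanguage_parWordLang hab hac hbc P Q hPQ ?_
    rcases hQ with rfl | rfl
    · exact Or.inl rfl
    · exact Or.inr (Or.inr (Or.inr rfl))
  · intro hP
    have hs := simple_of_mem_parWordLang hab hac hbc hP
    rcases hP with rfl | rfl | rfl | rfl
    · exact ⟨_, Or.inl rfl, hs.subsumed_refl⟩
    · exact ⟨_, Or.inl rfl, hs.subsumed hd (by simp [profile_pair, profile_word₂])
        (by simp [profile_pair, profile_word₂]) (by simp [profile_pair, profile_word₂])
        (by simp [profile_pair]) (by simp [profile_word₂])⟩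
    · exact ⟨_, Or.inl rfl, hs.subsumed hd (by simp [profile_pair, profile_word₂, Set.pair_comm])
        (by simp [profile_pair, profile_word₂]) (by simp [profile_pair, profile_word₂])
        (by simp [profile_pair]) (by simp [profile_word₂])⟩
    · exact ⟨_, Or.inr rfl, hs.subsumed_refl⟩

theorem subsumed_word_discrete (hab : a ≠ b) :
    Subsumed (word [a, b] false true) (discrete [a, b] ∅ {i | i.val = 1}) := by
  refine (word_simple (by simp [hab]) _ _).subsumed (discrete_simple (by simp [hab]) _ _)
    (by simp [profile_pair, profile_word₂]) (by simp [profile_pair, profile_word₂]) ?_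
    (by simp [profile_pair]) (by simp [profile_word₂])
  ext s
  simp [profile_pair, profile_word₂, Fin.exists_fin_succ, eq_comm]

theorem targets_discrete_pair (a b : Sg) :
    (discrete [a, b] ∅ {i | i.val = 1}).profile.targets = {b} := by
  ext s
  simp [profile_pair, Fin.exists_fin_succ, eq_comm]

/-- The remainder of an element of the language after a prefix with events `a` and `b`, of which
exactly `b` is still active. -/
theorem remainder_cases (hab : a ≠ b) (hac : a ≠ c) (hbc : b ≠ c) {P Q R : Ipomset Sg}
    (hP : P.profile.events = {a, b}) (hPT : P.profile.targets = {b})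
    (h : Glues P Q R) (hR : R ∈ parWordLang a b c) :
    Q = word [b] true false ∨ (P.profile.prec a b ∧ Q = word [b, c] true false) := by
  have hRs := simple_of_mem_parWordLang hab hac hbc hR
  obtain ⟨hPs, hQs, hPQ⟩ := h.simple_iff.1 hRs
  obtain ⟨⟨hS, hT⟩, hR⟩ := profile_of_mem_parWordLang hR
  have hQT : Q.profile.targets = ∅ := h.targets ▸ hT
  have hQS : Q.profile.sources = {b} := h.targets_eq_sources ▸ hPT
  have hE := h.events
  have hprec := h.prec hPs hQs
  have hconc := h.conc
  have hb : b ∈ Q.profile.events := sources_subset Q (by simp [hQS])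
  have ha : a ∉ Q.profile.events := fun ha => hab (by
    have : a ∈ P.profile.targets := hPQ ⟨by simp [hP], ha⟩
    simpa [hPT] using this)
  have hi := fun s => hQs.prec_irrefl (s := s)
  have hasymm := fun s t => hQs.prec_asymm (s := s) (t := t)
  have hci := fun s => hQs.conc_irrefl (s := s)
  have hcp := fun s t => hQs.not_prec_of_conc (s := s) (t := t)
  have hp := fun s t => mem_events_of_prec (P := Q) (s := s) (t := t)
  have hc := fun s t => mem_events_of_conc (P := Q) (s := s) (t := t)
  rw [hP] at hE
  rcases hR with ⟨hRE, -⟩ | ⟨hRE, h₁, h₂, h₃⟩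
  · left
    rw [hRE] at hE
    have hQE : Q.profile.events = {b} := by
      ext s
      have := Set.ext_iff.1 hE s
      simp only [Set.mem_union, Set.mem_insert_iff, Set.mem_singleton_iff] at this ⊢
      grind
    refine hQs.ext (word_simple (by simp) _ _) ?_
    rw [profile_word₁]
    ext r r' <;> simp <;> grind
  · right
    rw [hRE] at hE
    have hQE : Q.profile.events = {b, c} := by
      ext s
      have := Set.ext_iff.1 hE s
      simp only [Set.mem_union, Set.mem_insert_iff, Set.mem_singleton_iff] at this ⊢
      grind
    -- This precedence has to come from `Q`: `c` is not an event of `P`, and the mixed clause fails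
    -- because `b` is a target of `P`.
    have h₃' : Q.profile.prec b c := by
      have := (hprec b c).1 h₃
      have hPp := (mem_events_of_prec (P := P) (s := b) (t := c))
      rw [hP] at hPp
      simp only [hP, hPT, Set.mem_insert_iff, Set.mem_singleton_iff] at this hPp
      grind
    refine ⟨?_, ?_⟩
    -- Here it has to come from `P`: `a` is not an event of `Q`, and the mixed clause fails because
    -- `b` is a target of `P`.
    · have := (hprec a b).1 h₁
      rw [hPT] at this
      grind
    · refine hQs.ext (word_simple (by simp [hbc]) _ _) ?_
      rw [profile_word₂]
      ext r r' <;> simp <;> grind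

/-- Gluing with `•b` only terminates `b`; no event and no relation is added. -/
theorem exists_glues_word₁ (hab : a ≠ b) {P : Ipomset Sg} (hP : P.Simple)
    (hE : P.profile.events = {a, b}) (hS : P.profile.sources = ∅) (hT : P.profile.targets = {b})
    (h : ∀ s t, P.profile.conc s t → s = a ∧ t = b) :
    ∃ R ∈ parWordLang a b c, Glues P (word [b] true false) R := by
  have hw := word_simple (w := [b]) (by simp) true false
  obtain ⟨R, hR⟩ := hP.exists_glues hw (by simp [hT, profile_word₁]) (by
    simp [hT, profile_word₁, hP.conc_irrefl])
  refine ⟨R, mem_parWordLang_of_events_eq_pair hab (hR.simple_iff.2 ⟨hP, hw, ?_⟩) ?_ ?_ ?_ ?_, hR⟩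
  · simp [profile_word₁, hT]
  · simp [hR.events, profile_word₁, hE]
  · rw [hR.sources, hS]
  · simp [hR.targets, profile_word₁]
  · simpa [hR.conc, profile_word₁] using h

theorem exists_glues_word₂ (hab : a ≠ b) (hac : a ≠ c) (hbc : b ≠ c) :
    ∃ R ∈ parWordLang a b c, Glues (word [a, b] false true) (word [b, c] true false) R := by
  have hP := word_simple (w := [a, b]) (by simp [hab]) false true
  have hQ := word_simple (w := [b, c]) (by simp [hbc]) true false
  obtain ⟨R, hR⟩ := hP.exists_glues hQ (by simp [profile_word₂]) (by simp [profile_word₂])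
  refine ⟨R, Or.inr (Or.inr (Or.inr (eq_word₃ hab hac hbc (hR.simple_iff.2 ⟨hP, hQ, ?_⟩)
    ?_ ?_ ?_ ?_ ?_ ?_))), hR⟩
  · intro s
    simp only [profile_word₂]
    simp
    grind
  · simp only [hR.events, profile_word₂]
    ext s
    simp
    tauto
  · simp [hR.sources, profile_word₂]
  · simp [hR.targets, profile_word₂]
  all_goals
    rw [hR.prec hP hQ]
    simp only [profile_word₂]
    simp
  -- The remaining goal is that `a` precedes `c`. It holds by the mixed clause, `a` being already
  -- terminated and `c` not yet started.
  exact Or.inr (Or.inr ⟨hab, hbc.symm⟩)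

theorem prefixQuotient_word (hab : a ≠ b) (hac : a ≠ c) (hbc : b ≠ c) :
    prefixQuotient (word [a, b] false true) (parWordLang a b c) =
      {word [b] true false, word [b, c] true false} := by
  ext Q
  constructor
  · rintro ⟨R, hR, h⟩
    rcases remainder_cases hab hac hbc (by simp [profile_word₂]) (by simp [profile_word₂]) h hR with
      h | ⟨-, h⟩
    · exact Or.inl h
    · exact Or.inr h
  · rintro (rfl | rfl)
    · exact exists_glues_word₁ hab (word_simple (by simp [hab]) _ _) (by simp [profile_word₂])
        (by simp [profile_word₂]) (by simp [profile_word₂]) (by simp [profile_word₂])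
    · exact exists_glues_word₂ hab hac hbc

theorem prefixQuotient_discrete (hab : a ≠ b) (hac : a ≠ c) (hbc : b ≠ c) :
    prefixQuotient (discrete [a, b] ∅ {i | i.val = 1}) (parWordLang a b c) =
      {word [b] true false} := by
  ext Q
  constructor
  · rintro ⟨R, hR, h⟩
    rcases remainder_cases hab hac hbc (by simp [profile_pair]) (targets_discrete_pair a b) h hR
      with h | ⟨h, -⟩
    · exact h
    · simp [profile_pair] at h
  · rintro rfl
    exact exists_glues_word₁ hab (discrete_simple (by simp [hab]) _ _) (by simp [profile_pair])
      (by simp [profile_pair]) (targets_discrete_pair a b) (by simp [profile_pair])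

theorem word₂_ne_word₁ (hbc : b ≠ c) : word [b, c] true false ≠ word [b] true false := by
  intro h
  have : c ∈ (word [b] true false).profile.events := by
    rw [← h]
    simp [profile_word₂]
  simp [profile_word₁, hbc.symm] at this

/-- Swap-invariance is applied to `ab• ⊑ a ‖ b•` with the remainders `•bc` and `•b`; it would put
`•bc` into the quotient by `a ‖ b•`. -/
theorem not_swapInvariant_parWordLang (hab : a ≠ b) (hac : a ≠ c) (hbc : b ≠ c) :
    ¬ SwapInvariant (parWordLang a b c) := by
  intro h
  have h₁ : word [b, c] true false ∈
      prefixQuotient (word [a, b] false true) (parWordLang a b c) := by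
    rw [prefixQuotient_word hab hac hbc]
    exact Or.inr rfl
  have h₂ : word [b] true false ∈
      prefixQuotient (discrete [a, b] ∅ {i | i.val = 1}) (parWordLang a b c) := by
    rw [prefixQuotient_discrete hab hac hbc]
    exact rfl
  have h₃ : word [b, c] true false ∈
      prefixQuotient (discrete [a, b] ∅ {i | i.val = 1}) (parWordLang a b c) :=
    h _ _ _ _ h₁ h₂ (subsumed_word_discrete hab)
  rw [prefixQuotient_discrete hab hac hbc] at h₃
  exact word₂_ne_word₁ hbc h₃

end Ipomset

/-! ### Removing positions from a string -/

section RemoveAt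

variable {Sg : Type u}

theorem removeAt_sublist (U : List Sg) (A : Finset ℕ) : (removeAt U A).Sublist U := by
  have := (List.filter_sublist (p := fun p : Sg × ℕ => decide (p.2 ∉ A)) (l := U.zipIdx)).map
    Prod.fst
  rwa [List.zipIdx_map_fst] at this

theorem mem_removeAt (U : List Sg) (A : Finset ℕ) (s : Sg) :
    s ∈ removeAt U A ↔ s ∈ U.get '' {i | i.val ∉ A} := by
  simp only [removeAt, List.mem_map, List.mem_filter, Prod.exists, List.mem_zipIdx_iff_getElem?,
    decide_eq_true_eq, List.getElem?_eq_some_iff]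
  constructor
  · rintro ⟨_, i, ⟨⟨hi, h⟩, hA⟩, rfl⟩
    exact ⟨⟨i, hi⟩, hA, h⟩
  · rintro ⟨i, hA, rfl⟩
    exact ⟨_, i.1, ⟨⟨i.2, rfl⟩, hA⟩, rfl⟩

theorem removeAt_concat (U : List Sg) (s : Sg) (A : Finset ℕ) :
    removeAt (U ++ [s]) A = removeAt U A ++ if U.length ∈ A then [] else [s] := by
  by_cases h : U.length ∈ A <;> simp [removeAt, List.zipIdx_append, h]

theorem length_removeAt (U : List Sg) (A : Finset ℕ) :
    (removeAt U A).length = Nat.count (fun j => j ∉ A) U.length := by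
  induction U using List.reverseRecOn with
  | nil => rfl
  | append_singleton U s ih =>
    rw [List.length_append, List.length_singleton, Nat.count_succ, ← ih,
      removeAt_concat]
    by_cases h : U.length ∈ A <;> simp [h]

/-- Surviving positions are renumbered onto an initial segment, since each is sent to the number of
survivors below it. -/
theorem reindex_range_sdiff (A : Finset ℕ) (n : ℕ) :
    reindex A (Finset.range n \ A) = Finset.range (Nat.count (fun j => j ∉ A) n) := by
  induction n with
  | zero => simp [reindex]
  | succ n ih =>
    rw [Finset.range_add_one, Nat.count_succ]
    by_cases h : n ∈ A
    · rw [Finset.insert_sdiff_of_mem _ h, ih]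
      simp [h]
    · rw [Finset.insert_sdiff_of_notMem _ h, reindex, Finset.image_insert]
      simp only [h, not_false_eq_true, if_true]
      rw [Finset.range_add_one, ← ih, reindex]

/-- Thus a face of a face can be rewritten as a single face of the original cell. -/
theorem exists_reindex_eq {U : List Sg} {A B : Finset ℕ}
    (hB : B ⊆ Finset.range (removeAt U A).length) :
    ∃ C ⊆ Finset.range U.length, Disjoint A C ∧ reindex A C = B := by
  rw [length_removeAt, ← reindex_range_sdiff, reindex, Finset.subset_image_iff] at hB
  obtain ⟨C, hC, rfl⟩ := hB
  exact ⟨C, fun i hi => (Finset.mem_sdiff.1 (hC hi)).1,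
    Finset.disjoint_right.2 fun i hi => (Finset.mem_sdiff.1 (hC hi)).2, rfl⟩

/-- In a string without repetitions, removing a position loses its label. -/
theorem eq_empty_of_subset_image_get {V : List Sg} (hV : V.Nodup) {B : Finset ℕ}
    (hB : B ⊆ Finset.range V.length) (h : ∀ s ∈ V, s ∈ V.get '' {i | i.val ∉ B}) : B = ∅ := by
  refine Finset.eq_empty_of_forall_notMem fun i hi => ?_
  have hi' : i < V.length := Finset.mem_range.1 (hB hi)
  obtain ⟨j, hj, hij⟩ := h _ (List.get_mem V ⟨i, hi'⟩)
  rw [List.nodup_iff_injective_get.1 hV hij] at hj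
  exact hj hi

theorem image_get_notMem_empty (V : List Sg) :
    V.get '' {i | i.val ∉ (∅ : Finset ℕ)} = {s | s ∈ V} := by
  have : {i : Fin V.length | i.val ∉ (∅ : Finset ℕ)} = Set.univ := by simp
  rw [this, Set.image_univ, Set.range_list_get]

theorem eq_nil_or_eq_singleton {V : List Sg} (hV : V.Nodup) {s : Sg} (h : ∀ t ∈ V, t = s) :
    V = [] ∨ V = [s] := by
  match V with
  | [] => exact Or.inl rfl
  | [x] => exact Or.inr (by rw [h x (by simp)])
  | x :: y :: W =>
    have h₁ := h x (by simp)
    have h₂ := h y (by simp)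
    simp [h₁, h₂] at hV

theorem eq_pair_of_pairwise {V : List Sg} {r : Sg → Sg → Prop} (hr : V.Pairwise r)
    (hV : V.Nodup) {a b : Sg} (hab : a ≠ b) (h : ∀ s, s ∈ V ↔ s = a ∨ s = b) (hba : ¬ r b a) :
    V = [a, b] := by
  match V with
  | [] => simpa using h a
  | [x] =>
    have h₁ := h a
    have h₂ := h b
    simp at h₁ h₂
    exact absurd (h₁.trans h₂.symm) hab
  | [x, y] =>
    have h₁ := h a
    have h₂ := h b
    simp at h₁ h₂ hr
    grind
  | x :: y :: z :: W =>
    have h₁ := (h x).1 (by simp)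
    have h₂ := (h y).1 (by simp)
    have h₃ := (h z).1 (by simp)
    simp only [List.nodup_cons, List.mem_cons] at hV
    grind

end RemoveAt

/-! ### Gluing with starters and terminators -/

namespace Ipomset

variable {Sg : Type u} {P Q R : Ipomset Sg}

theorem Glues.simple_left (h : Glues P Q R) (hR : R.Simple) : P.Simple := (h.simple_iff.1 hR).1

theorem Glues.simple_right (h : Glues P Q R) (hR : R.Simple) : Q.Simple := (h.simple_iff.1 hR).2.1

theorem Glues.inter_subset (h : Glues P Q R) (hR : R.Simple) :
    P.profile.events ∩ Q.profile.events ⊆ P.profile.targets := (h.simple_iff.1 hR).2.2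

/-- Gluing with a discrete ipomset all of whose events are source events. -/
theorem Glues.of_sources_eq {V : List Sg} {S T} (h : Glues P (discrete V S T) R) (hR : R.Simple)
    (hS : ∀ s ∈ V, s ∈ V.get '' S) : R.profile.events = P.profile.events ∧
      ∀ s t, R.profile.prec s t ↔ P.profile.prec s t := by
  have hVP : ∀ s ∈ V, s ∈ P.profile.targets := fun s hs => by
    rw [h.targets_eq_sources]
    exact hS s hs
  constructor
  · rw [h.events, discrete_events]
    exact Set.union_eq_left.2 fun s hs => targets_subset P (hVP s hs)
  · intro s t
    rw [h.prec (h.simple_left hR) (h.simple_right hR)]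
    refine ⟨?_, Or.inl⟩
    rintro (h' | h' | ⟨-, h', h''⟩)
    · exact h'
    · exact absurd h' (not_discrete_prec _ _ _ _ _)
    · rw [discrete_events] at h'
      exact absurd (hVP t h') h''

theorem Glues.events_eq_of_terminator {V : List Sg} {B : Finset ℕ}
    (h : Glues P (terminator V B) R) (hR : R.Simple) : R.profile.events = P.profile.events ∧
      ∀ s t, R.profile.prec s t ↔ P.profile.prec s t :=
  h.of_sources_eq hR fun s hs => by simpa using List.mem_iff_get.1 hs

theorem Glues.events_eq_of_starter_empty {V : List Sg} (h : Glues P (starter V ∅) R)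
    (hR : R.Simple) : R.profile.events = P.profile.events ∧
      ∀ s t, R.profile.prec s t ↔ P.profile.prec s t :=
  h.of_sources_eq hR fun s hs => by simpa using List.mem_iff_get.1 hs

theorem Glues.targets_starter {V : List Sg} {A : Finset ℕ} (h : Glues P (starter V A) R) :
    R.profile.targets = {s | s ∈ V} ∧ P.profile.targets = V.get '' {i | i.val ∉ A} := by
  refine ⟨?_, h.targets_eq_sources⟩
  rw [h.targets, starter, discrete_targets, Set.image_univ, Set.range_list_get]

theorem Glues.targets_terminator {V : List Sg} {A : Finset ℕ} (h : Glues P (terminator V A) R) :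
    P.profile.targets = {s | s ∈ V} ∧ R.profile.targets = V.get '' {i | i.val ∉ A} := by
  refine ⟨?_, h.targets⟩
  rw [h.targets_eq_sources, terminator, discrete_sources, Set.image_univ, Set.range_list_get]

end Ipomset

/-! ### Cells along paths -/

namespace HDA

open Ipomset

variable {Sg : Type u} {X : HDA.{u, v} Sg} {x y : X.cell} {R : Ipomset Sg}

/-- Removing the events of `A` and then all remaining ones amounts to removing all at once, so a
lower (upper) face has the same initial (final) vertex as the cell. -/
theorem face_events_face (A : Finset ℕ) (hA : A ⊆ X.events y) (ν : Bool) :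
    X.face ν (X.events (X.face ν A y)) (X.face ν A y) = X.face ν (X.events y) y := by
  have h : X.events (X.face ν A y) = reindex A (X.events y \ A) := by
    rw [events, X.ev_face ν A y hA, length_removeAt, events, reindex_range_sdiff]
  rw [h]
  refine (X.face_union ν A _ y hA Finset.sdiff_subset Finset.disjoint_sdiff).trans ?_
  rw [← events, Finset.union_sdiff_of_subset hA]

theorem Path.HasEvent.targets {α : Path X x y} (h : α.HasEvent R) :
    R.profile.targets = {s | s ∈ X.ev y} := by
  cases α with
  | nil =>
    obtain rfl := h
    exact Set.image_univ.trans (Set.range_list_get _)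
  | up α z A hA hz =>
    obtain ⟨P, -, hG⟩ := h
    exact hG.targets_starter.1
  | down α z B hB hz =>
    obtain ⟨P, -, hG⟩ := h
    subst hz
    rw [hG.targets_terminator.2, X.ev_face _ _ _ hB]
    ext s
    exact (mem_removeAt _ _ _).symm

theorem pairwise_discrete_conc (U : List Sg) (S T) :
    U.Pairwise (discrete U S T).profile.conc :=
  List.pairwise_iff_get.2 fun i j h => (discrete_conc _ _ _ _ _).2 ⟨i, j, h, rfl, rfl⟩

/-- The event order of the last cell is visible in the event ipomset: the last step contributes it,
and gluing retains concurrent pairs of either factor. -/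
theorem Path.HasEvent.pairwise {α : Path X x y} (h : α.HasEvent R) :
    (X.ev y).Pairwise R.profile.conc := by
  cases α with
  | nil =>
    obtain rfl := h
    exact pairwise_discrete_conc _ _ _
  | up α z A hA hz =>
    obtain ⟨P, -, hG⟩ := h
    exact (pairwise_discrete_conc _ _ _).imp fun h => (hG.conc _ _).2 (Or.inr h)
  | down α z B hB hz =>
    obtain ⟨P, -, hG⟩ := h
    subst hz
    rw [X.ev_face _ _ _ hB]
    exact ((pairwise_discrete_conc _ _ _).sublist (removeAt_sublist _ _)).imp
      fun h => (hG.conc _ _).2 (Or.inr h)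

theorem Path.HasEvent.nodup {α : Path X x y} (h : α.HasEvent R) (hR : R.Simple) :
    (X.ev y).Nodup :=
  h.pairwise.imp fun h' => by
    rintro rfl
    exact hR.conc_irrefl h'

/-- A path all of whose events are still active, and which has no source events, starts in the
initial vertex of its last cell. -/
theorem Path.HasEvent.face_false_events {α : Path X x y} (h : α.HasEvent R) (hR : R.Simple)
    (hS : R.profile.sources = ∅) (hT : R.profile.events ⊆ R.profile.targets) :
    X.face false (X.events y) y = x := by
  induction α generalizing R with
  | nil =>
    obtain rfl := h
    have hx : X.ev x = [] := by
      rw [idt, discrete_sources, Set.image_univ, Set.range_list_get] at hS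
      exact List.eq_nil_iff_forall_not_mem.2 fun s hs => (hS ▸ hs : s ∈ (∅ : Set Sg))
    rw [events, hx]
    exact X.face_empty _ _
  | up α z A hA hz ih =>
    obtain ⟨P, hP, hG⟩ := h
    subst hz
    rw [← ih hP (hG.simple_left hR) (hG.sources ▸ hS) ?_, face_events_face A hA]
    intro s hs
    refine hG.inter_subset hR ⟨hs, ?_⟩
    have : s ∈ R.profile.targets := hT (hG.events ▸ Or.inl hs)
    rw [hG.targets] at this
    exact targets_subset _ this
  | down α z B hB hz ih =>
    obtain ⟨P, hP, hG⟩ := h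
    subst hz
    have hV := simple_discrete_iff.1 (hG.simple_right hR)
    have hTP := hG.targets_terminator
    obtain ⟨hE, -⟩ := hG.events_eq_of_terminator hR
    -- A terminated event would be an event of `R` outside its target interface, so only empty
    -- downsteps can occur.
    have hB' : B = ∅ := by
      refine eq_empty_of_subset_image_get hV hB fun s hs => ?_
      rw [← hTP.2]
      refine hT (hE ▸ targets_subset P ?_)
      rwa [hTP.1]
    subst hB'
    rw [X.face_empty]
    refine ih hP (hG.simple_left hR) (hG.sources ▸ hS) fun s hs => ?_
    have := hT (hE ▸ hs)
    rw [hTP.2] at this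
    rw [hTP.1]
    obtain ⟨i, -, rfl⟩ := this
    exact List.get_mem _ _

/-- If the event ipomset of a path has a greatest event `s` and at most `s` is active, then the path
ends by passing an edge labelled with `s`. -/
theorem Path.HasEvent.exists_last_edge {α : Path X x y} (h : α.HasEvent R) (hR : R.Simple)
    (hS : R.profile.sources = ∅) {s : Sg} (hs : s ∈ R.profile.events)
    (hmax : ∀ t ∈ R.profile.events, t ≠ s → R.profile.prec t s)
    (hT : ∀ t ∈ R.profile.targets, t = s) :
    ∃ g, X.ev g = [s] ∧ (s ∈ R.profile.targets → y = g) ∧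
      (s ∉ R.profile.targets → y = X.face true {0} g) ∧
      ∃ (β : Path X x (X.face false {0} g)) (P : Ipomset Sg), β.HasEvent P ∧ P.Simple ∧
        P.profile.sources = ∅ ∧ P.profile.targets = ∅ ∧ P.profile.events = R.profile.events \ {s} ∧
        ∀ t u, u ≠ s → R.profile.prec t u → P.profile.prec t u := by
  induction α generalizing R with
  | nil =>
    obtain rfl := h
    exact absurd hs (by
      change s ∈ (discrete _ _ _).profile.events → False
      rw [discrete_events]
      intro hs
      have : s ∈ (∅ : Set Sg) := by
        rw [← hS, idt, discrete_sources, Set.image_univ, Set.range_list_get]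
        exact hs
      exact this)
  | up α z A hA hz ih =>
    obtain ⟨P, hP, hG⟩ := h
    subst hz
    have hV := simple_discrete_iff.1 (hG.simple_right hR)
    have hTR := hG.targets_starter
    rw [hTR.1] at hT
    -- An empty step stays at the same cell and changes no relevant data; a nonempty upstep has to
    -- start `s` itself.
    rcases Finset.eq_empty_or_nonempty A with rfl | hA'
    · obtain ⟨hE, hp⟩ := hG.events_eq_of_starter_empty hR
      have hTP : P.profile.targets = R.profile.targets := by
        rw [hTR.1, hTR.2, image_get_notMem_empty]
      have := ih hP (hG.simple_left hR) (hG.sources ▸ hS) (hE ▸ hs)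
        (fun t ht hts => (hp _ _).1 (hmax t (hE ▸ ht) hts)) (by rwa [hTP, hTR.1])
      simp only [X.face_empty] at this
      simpa only [hE, hp, hTP] using this
    · have hz : X.ev z = [s] := by
        rcases eq_nil_or_eq_singleton hV hT with h | h
        · rw [events, h] at hA
          exact absurd (Finset.subset_empty.1 hA) hA'.ne_empty
        · exact h
      have hA : A = {0} := by
        rw [events, hz] at hA
        exact (Finset.subset_singleton_iff.1 hA).resolve_left hA'.ne_empty
      subst hA
      have hsR : s ∈ R.profile.targets := by simp [hTR.1, hz]
      have hTP : P.profile.targets = ∅ := by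
        rw [hTR.2, Set.image_eq_empty]
        ext i
        have := i.2
        simp only [hz, List.length_singleton] at this
        simp
        omega
      have hsP : s ∉ P.profile.events := fun h => by
        have := hG.inter_subset hR ⟨h, by simp [starter, discrete_events, hz]⟩
        simp [hTP] at this
      refine ⟨z, hz, fun _ => rfl, fun h => absurd hsR h, α, P, hP, hG.simple_left hR,
        hG.sources ▸ hS, hTP, ?_, fun t u hu h => ?_⟩
      · rw [hG.events, starter, discrete_events, hz]
        ext t
        simp
        grind
      · rw [hG.prec (hG.simple_left hR) (hG.simple_right hR), starter, discrete_events, hz] at h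
        rcases h with h | h | ⟨-, h, -⟩
        · exact h
        · exact absurd h (not_discrete_prec _ _ _ _ _)
        · exact absurd (by simpa using h) hu
  | @down y' α z B hB hz ih =>
    obtain ⟨P, hP, hG⟩ := h
    subst hz
    have hV := simple_discrete_iff.1 (hG.simple_right hR)
    have hTR := hG.targets_terminator
    obtain ⟨hE, hp⟩ := hG.events_eq_of_terminator hR
    have hPs := hG.simple_left hR
    have hmaxP : ∀ t ∈ P.profile.events, t ≠ s → P.profile.prec t s := fun t ht hts =>
      (hp _ _).1 (hmax t (hE ▸ ht) hts)
    -- Every event other than `s` precedes `s`, hence is not maximal and cannot be a target. So the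
    -- induction hypothesis applies before the downstep too, and the cell left by a nonempty
    -- downstep is an edge labelled `s`.
    have hTP : ∀ t ∈ P.profile.targets, t = s := fun t ht => by
      by_contra hts
      exact hPs.target_maximal ht (hmaxP t (targets_subset P ht) hts)
    obtain ⟨g, hg, h₁, h₂, β, P', hP'⟩ := ih hP hPs (hG.sources ▸ hS) (hE ▸ hs) hmaxP hTP
    have key : (s ∈ R.profile.targets → X.face true B y' = g) ∧
        (s ∉ R.profile.targets → X.face true B y' = X.face true {0} g) := by
      rw [hTR.1] at hTP
      rcases Finset.eq_empty_or_nonempty B with rfl | hB'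
      · have : R.profile.targets = P.profile.targets := by
          rw [hTR.1, hTR.2, image_get_notMem_empty]
        rw [this, X.face_empty]
        exact ⟨h₁, h₂⟩
      · have hy : X.ev y' = [s] := by
          rcases eq_nil_or_eq_singleton hV hTP with h | h
          · rw [events, h] at hB
            exact absurd (Finset.subset_empty.1 hB) hB'.ne_empty
          · exact h
        have hB : B = {0} := by
          rw [events, hy] at hB
          exact (Finset.subset_singleton_iff.1 hB).resolve_left hB'.ne_empty
        subst hB
        have hsR : s ∉ R.profile.targets := by
          rw [hTR.2]
          rintro ⟨i, hi, -⟩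
          have := i.2
          simp only [hy, List.length_singleton] at this
          simp at hi
          omega
        refine ⟨fun h => absurd h hsR, fun _ => ?_⟩
        rw [h₁ (by simp [hTR.1, hy])]
    refine ⟨g, hg, key.1, key.2, β, P', ?_⟩
    simpa only [hE, hp] using hP'

/-- With both events still active, the last cell carries exactly these two, and nothing has been
terminated on the way from the initial vertex. -/
theorem Path.HasEvent.face_square_of_active {α : Path X x y} (h : α.HasEvent R) (hR : R.Simple)
    (hS : R.profile.sources = ∅) {a b : Sg} (hab : a ≠ b) (hE : R.profile.events = {a, b})
    (hc : ¬ R.profile.conc b a) (hET : R.profile.events ⊆ R.profile.targets) :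
    X.ev y = [a, b] ∧ X.face false {0, 1} y = x := by
  have hy : X.ev y = [a, b] := by
    refine eq_pair_of_pairwise h.pairwise (h.nodup hR) hab (fun s => ?_) hc
    have : s ∈ R.profile.targets ↔ s ∈ X.ev y := by rw [h.targets]; rfl
    rw [← this, (targets_subset R).antisymm hET, hE]
    simp
  have := h.face_false_events hR hS hET
  rw [events, hy] at this
  exact ⟨hy, this⟩

/-- If the event ipomset of a path consists of two concurrent events, then the path starts in the
initial vertex of a square, and it ends in an upper face of this square. -/
theorem Path.HasEvent.exists_square {α : Path X x y} (h : α.HasEvent R) (hR : R.Simple)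
    (hS : R.profile.sources = ∅) {a b : Sg} (hab : a ≠ b) (hE : R.profile.events = {a, b})
    (hp : ∀ s t, ¬ R.profile.prec s t) (hc : ¬ R.profile.conc b a) :
    ∃ q, X.ev q = [a, b] ∧ X.face false {0, 1} q = x ∧
      ∃ C ⊆ X.events q, y = X.face true C q := by
  induction α generalizing R with
  | nil =>
    obtain ⟨hy, hx⟩ := h.face_square_of_active hR hS hab hE hc (by
      obtain rfl := h
      rw [idt, discrete_events, discrete_targets, Set.image_univ, Set.range_list_get])
    exact ⟨x, hy, hx, ∅, by simp, (X.face_empty _ _).symm⟩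
  | up α z A hA hz ih =>
    by_cases hET : R.profile.events ⊆ R.profile.targets
    · obtain ⟨hz, hx⟩ := h.face_square_of_active hR hS hab hE hc hET
      exact ⟨z, hz, hx, ∅, by simp, (X.face_empty _ _).symm⟩
    obtain ⟨P, hP, hG⟩ := h
    subst hz
    have hPs := hG.simple_left hR
    have hTR := hG.targets_starter
    have hV := simple_discrete_iff.1 (hG.simple_right hR)
    -- By now some event `t` has been terminated. If this step started an event `s`, gluing would
    -- make `t` precede `s`, contrary to `hp`.
    have hA : A = ∅ := by
      refine eq_empty_of_subset_image_get hV hA fun s hs => ?_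
      by_contra hsP
      refine hET fun t ht => ?_
      by_contra htR
      have htz : t ∉ X.ev z := by simpa [hTR.1] using htR
      have htP : t ∉ P.profile.targets := by
        rw [hTR.2]
        rintro ⟨i, -, rfl⟩
        exact htz (List.get_mem _ _)
      rw [hG.events, starter, discrete_events] at ht
      refine hp t s ((hG.prec hPs (hG.simple_right hR) t s).2 (Or.inr (Or.inr
        ⟨⟨ht.resolve_right htz, htP⟩, ?_, ?_⟩)))
      · rwa [starter, discrete_events]
      · rwa [hTR.2]
    subst hA
    obtain ⟨hE', hp'⟩ := hG.events_eq_of_starter_empty hR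
    have hE'' : P.profile.events = {a, b} := hE' ▸ hE
    have hcP : ¬ P.profile.conc b a := fun h => hc ((hG.conc _ _).2 (Or.inl h))
    have := ih hP hPs (hG.sources ▸ hS) hE'' (fun s t h => hp s t ((hp' s t).2 h)) hcP
    simpa only [X.face_empty] using this
  | @down y' α z B hB hz ih =>
    obtain ⟨P, hP, hG⟩ := h
    subst hz
    have hPs := hG.simple_left hR
    obtain ⟨hE', hp'⟩ := hG.events_eq_of_terminator hR
    have hE'' : P.profile.events = {a, b} := hE' ▸ hE
    have hcP : ¬ P.profile.conc b a := fun h => hc ((hG.conc _ _).2 (Or.inl h))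
    obtain ⟨q, hq, hx, C, hC, rfl⟩ := ih hP hPs (hG.sources ▸ hS) hE''
      (fun s t h => hp s t ((hp' s t).2 h)) hcP
    rw [events, X.ev_face _ _ _ hC] at hB
    -- The downstep takes an upper face of an upper face of `q`, which is again an upper face of
    -- `q`.
    obtain ⟨D, hD, hCD, rfl⟩ := exists_reindex_eq hB
    exact ⟨q, hq, hx, C ∪ D, Finset.union_subset hC hD, X.face_union _ _ _ _ hC hD hCD⟩

end HDA

/-! ### Constructing paths, and the contradiction with determinism. -/

namespace HDA

open Ipomset

variable {Sg : Type u} {X : HDA.{u, v} Sg} {x y : X.cell} {R : Ipomset Sg}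

theorem subset_events_of_ev_eq {n : ℕ} {U : List Sg} (hx : X.ev x = U) (A : Finset ℕ)
    (hU : U.length = n) (hA : A ⊆ Finset.range n) : A ⊆ X.events x := by
  rwa [events, hx, hU]

/-- Extend a path by passing an edge. -/
def Path.edge (α : Path X x y) (g : X.cell) {s : Sg} (hg : X.ev g = [s])
    (h : X.face false {0} g = y) : Path X x (X.face true {0} g) :=
  (α.up g {0} (by simp [events, hg]) h).down _ {0} (by simp [events, hg]) rfl

theorem starter_singleton_profile (s : Sg) : (starter [s] {0}).profile =
    ⟨{s}, ∅, {s}, fun _ _ => False, fun _ _ => False⟩ := by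
  ext r t
  · simp [starter, discrete_events]
  · simp [starter, discrete_sources]
  · simp [starter, discrete_targets]
  · simp [starter, not_discrete_prec]
  · simp only [starter, discrete_conc, exists_lt_get_cons, exists_lt_get_nil]
    simp

theorem terminator_singleton_profile (s : Sg) : (terminator [s] {0}).profile =
    ⟨{s}, {s}, ∅, fun _ _ => False, fun _ _ => False⟩ := by
  ext r t
  · simp [terminator, discrete_events]
  · simp [terminator, discrete_sources]
  · simp [terminator, discrete_targets]
  · simp [terminator, not_discrete_prec]
  · simp only [terminator, discrete_conc, exists_lt_get_cons, exists_lt_get_nil]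
    simp

/-- Since nothing is active before the edge, every earlier event is terminated and therefore
precedes `s`. -/
theorem Path.HasEvent.edge {α : Path X x y} {P : Ipomset Sg} (h : α.HasEvent P) (hP : P.Simple)
    (hT : P.profile.targets = ∅) {g : X.cell} {s : Sg} (hg : X.ev g = [s])
    (hgy : X.face false {0} g = y) (hs : s ∉ P.profile.events) :
    ∃ R, (α.edge g hg hgy).HasEvent R ∧ R.Simple ∧ R.profile =
      ⟨insert s P.profile.events, P.profile.sources, ∅,
        fun r t => P.profile.prec r t ∨ r ∈ P.profile.events ∧ t = s, P.profile.conc⟩ := by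
  have h₁ : (starter [s] {0}).Simple := discrete_simple (by simp) _ _
  have h₂ : (terminator [s] {0}).Simple := discrete_simple (by simp) _ _
  obtain ⟨Q, hQ⟩ := hP.exists_glues h₁ (by simp [hT, starter_singleton_profile]) (by simp [hT])
  have hQs : Q.Simple := hQ.simple_iff.2 ⟨hP, h₁, by simp [starter_singleton_profile, hs]⟩
  have hQT : Q.profile.targets = {s} := by simp [hQ.targets, starter_singleton_profile]
  obtain ⟨R, hR⟩ := hQs.exists_glues h₂ (by simp [hQT, terminator_singleton_profile])
    (by simp [hQT, hQs.conc_irrefl, terminator_singleton_profile])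
  have hRs : R.Simple := hR.simple_iff.2 ⟨hQs, h₂, by simp [terminator_singleton_profile, hQT]⟩
  refine ⟨R, ⟨Q, ⟨P, h, by rwa [hg]⟩, by rwa [hg]⟩, hRs, ?_⟩
  ext r t
  · simp [hR.events, hQ.events, starter_singleton_profile, terminator_singleton_profile]
  · simp [hR.sources, hQ.sources]
  · simp [hR.targets, terminator_singleton_profile]
  · simp [hR.prec hQs h₂, hQ.prec hP h₁, starter_singleton_profile,
      terminator_singleton_profile, hT, hQT]
  · simp [hR.conc, hQ.conc, starter_singleton_profile, terminator_singleton_profile]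

/-- The path through a square which starts both events and then terminates both events. -/
def Path.square (q : X.cell) {a b : Sg} (hq : X.ev q = [a, b]) :
    Path X (X.face false {0, 1} q) (X.face true {0, 1} q) :=
  (Path.nil.up q {0, 1} (subset_events_of_ev_eq (n := 2) hq _ rfl (by decide)) rfl).down _ {0, 1}
    (subset_events_of_ev_eq (n := 2) hq _ rfl (by decide)) rfl

theorem idt_nil_simple : (idt ([] : List Sg)).Simple := discrete_simple List.nodup_nil _ _

theorem idt_nil_profile : (idt ([] : List Sg)).profile =
    ⟨∅, ∅, ∅, fun _ _ => False, fun _ _ => False⟩ := by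
  ext r t
  · simp [idt, discrete_events]
  · simp [idt, discrete_sources]
  · simp [idt, discrete_targets]
  · simp [idt, not_discrete_prec]
  · simp only [idt, discrete_conc, exists_lt_get_nil]

theorem Path.HasEvent.square {q : X.cell} {a b : Sg} (hab : a ≠ b) (hq : X.ev q = [a, b]) :
    (Path.square q hq).HasEvent (discrete [a, b] ∅ ∅) := by
  have h₀ : X.ev (X.face false {0, 1} q) = [] := by
    rw [X.ev_face _ _ _ (subset_events_of_ev_eq (n := 2) hq _ rfl (by decide)), hq]
    rfl
  have hn : [a, b].Nodup := by simp [hab]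
  have h₁ : (starter [a, b] {0, 1}).Simple := discrete_simple hn _ _
  have h₂ : (terminator [a, b] {0, 1}).Simple := discrete_simple hn _ _
  have e₁ : (starter [a, b] {0, 1}).profile =
      ⟨{a, b}, ∅, {a, b}, fun _ _ => False, fun s t => s = a ∧ t = b⟩ := by
    rw [starter, profile_pair]
    ext s t <;> simp [Fin.exists_fin_succ, eq_comm]
  have e₂ : (terminator [a, b] {0, 1}).profile =
      ⟨{a, b}, {a, b}, ∅, fun _ _ => False, fun s t => s = a ∧ t = b⟩ := by
    rw [terminator, profile_pair]
    ext s t <;> simp [Fin.exists_fin_succ, eq_comm]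
  obtain ⟨Q, hQ⟩ := idt_nil_simple.exists_glues h₁ (by simp [e₁, idt_nil_profile])
    (by simp [idt_nil_profile])
  have hQs : Q.Simple := hQ.simple_iff.2 ⟨idt_nil_simple, h₁, by simp [idt_nil_profile]⟩
  have hQT : Q.profile.targets = {a, b} := by simp [hQ.targets, e₁]
  obtain ⟨R, hR⟩ := hQs.exists_glues h₂ (by simp [e₂, hQT])
    (fun s _ t _ => by simp [e₁, e₂, hQ.conc, idt_nil_profile])
  have hRs : R.Simple := hR.simple_iff.2 ⟨hQs, h₂, by simp [hQT, e₂]⟩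
  have : R = discrete [a, b] ∅ ∅ := by
    refine hRs.ext (discrete_simple hn _ _) ?_
    rw [profile_pair]
    ext s t
    · simp [hR.events, hQ.events, idt_nil_profile, e₁, e₂]
    · simp [hR.sources, hQ.sources, idt_nil_profile]
    · simp [hR.targets, e₂]
    · simp [hR.prec hQs h₂, hQ.prec idt_nil_simple h₁, idt_nil_profile, e₁, e₂, hQT]
      grind
    · simp [hR.conc, hQ.conc, idt_nil_profile, e₁, e₂]
  subst this
  exact ⟨Q, ⟨_, rfl, by rwa [hq, h₀]⟩, by rwa [hq]⟩

/-- The path consisting of three consecutive edges in the event ipomset `abc`. -/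
theorem Path.HasEvent.exists_three_edges {a b c : Sg} (hab : a ≠ b) (hac : a ≠ c) (hbc : b ≠ c)
    {α : Path X x y} (h : α.HasEvent (word [a, b, c] false false)) :
    ∃ e f g, X.ev e = [a] ∧ X.ev f = [b] ∧ X.ev g = [c] ∧ X.face false {0} e = x ∧
      X.face false {0} f = X.face true {0} e ∧ X.face false {0} g = X.face true {0} f ∧
      X.face true {0} g = y := by
  have hR := word_simple (w := [a, b, c]) (by simp [*]) false false
  obtain ⟨g, hg, -, hyg, β, P, hβ, hP, hPS, hPT, hPE, hp⟩ := h.exists_last_edge hR (s := c)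
    (by simp [profile_word₃]) (by simp [profile_word₃]) (by simp [profile_word₃])
    (by simp [profile_word₃])
  have hPE : P.profile.events = {a, b} := by
    rw [hPE, profile_word₃]
    ext s
    simp
    grind
  have hPp : P.profile.prec a b := hp a b hbc (by simp [profile_word₃])
  obtain ⟨f, hf, -, hgf, γ, Q, hγ, hQ, hQS, hQT, hQE, -⟩ := hβ.exists_last_edge hP hPS (s := b)
    (by simp [hPE]) (fun t ht htb => by
      rw [hPE] at ht
      rwa [ht.resolve_right htb]) (by simp [hPT])
  have hQE : Q.profile.events = {a} := by
    rw [hQE, hPE]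
    ext s
    simp
    grind
  obtain ⟨e, he, -, hfe, δ, T, hδ, hT, hTS, hTT, hTE, -⟩ := hγ.exists_last_edge hQ hQS (s := a)
    (by simp [hQE]) (fun t ht htb => by
      rw [hQE] at ht
      exact absurd ht htb) (by simp [hQT])
  have hx := hδ.face_false_events hT hTS (by simp [hTE, hQE])
  have he' : X.ev (X.face false {0} e) = [] := by
    rw [X.ev_face _ _ _ (subset_events_of_ev_eq (n := 1) he _ rfl (by decide)), he]
    rfl
  rw [events, he'] at hx
  refine ⟨e, f, g, he, hf, hg, (X.face_empty _ _).symm.trans hx, hfe ?_, hgf ?_, (hyg ?_).symm⟩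
  · simp [hQT]
  · simp [hPT]
  · simp [profile_word₃]

/-- Determinism glues the path for `abc` onto the boundary of the square for `a ‖ b`, which lets the
`c`-edge be taken after the interior of the square. -/
theorem not_deterministic_of_lang_eq {a b c : Sg} (hab : a ≠ b) (hac : a ≠ c) (hbc : b ≠ c)
    (hX : X.lang = parWordLang a b c) : ¬ X.Deterministic := by
  intro hdet
  obtain ⟨x₁, hx₁, y₁, hy₁, α₁, hα₁⟩ : discrete [a, b] ∅ ∅ ∈ X.lang := hX ▸ Or.inl rfl
  obtain ⟨x₂, hx₂, y₂, hy₂, α₂, hα₂⟩ : word [a, b, c] false false ∈ X.lang :=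
    hX ▸ Or.inr (Or.inr (Or.inr rfl))
  have hds := discrete_simple (U := [a, b]) (by simp [hab]) ∅ ∅
  obtain ⟨q, hq, rfl, C, hC, rfl⟩ := hα₁.exists_square hds (by simp [profile_pair]) hab
    (by simp [profile_pair]) (by simp [profile_pair]) (by simp [profile_pair, hab.symm])
  have hqC : X.ev (X.face true C q) = [] := by
    have := hα₁.targets
    rw [profile_pair, Set.image_empty] at this
    refine List.eq_nil_iff_forall_not_mem.2 fun s hs => ?_
    have hs' : s ∈ {s | s ∈ X.ev (X.face true C q)} := hs
    rw [← this] at hs'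
    exact hs'
  -- The final cell has no events, so neither position of `[a, b]` survives.
  have hC' : C = {0, 1} := by
    have hl := congrArg List.length hqC
    rw [X.ev_face _ _ _ hC, length_removeAt, hq] at hl
    rw [events, hq] at hC
    have : C ∈ (Finset.range 2).powerset := Finset.mem_powerset.2 hC
    have key : ∀ C ∈ (Finset.range 2).powerset, Nat.count (fun j => j ∉ C) 2 = 0 →
        C = {0, 1} := by decide
    exact key C this hl
  subst hC'
  obtain ⟨e, f, g, he, hf, hg, rfl, hfe, hgf, rfl⟩ := hα₂.exists_three_edges hab hac hbc
  have hq0 : ({0} : Finset ℕ) ⊆ X.events q :=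
    subset_events_of_ev_eq (n := 2) hq _ rfl (by decide)
  have hq1 : ({1} : Finset ℕ) ⊆ X.events q :=
    subset_events_of_ev_eq (n := 2) hq _ rfl (by decide)
  have hq01 : ({0, 1} : Finset ℕ) ⊆ X.events q :=
    subset_events_of_ev_eq (n := 2) hq _ rfl (by decide)
  have evx₁ : X.ev (X.face false {0, 1} q) = [] := by
    rw [X.ev_face _ _ _ hq01, hq]
    rfl
  have evx₂ : X.ev (X.face false {0} e) = [] := by
    rw [X.ev_face _ _ _ (subset_events_of_ev_eq (n := 1) he _ rfl (by decide)), he]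
    rfl
  have hx : X.face false {0, 1} q = X.face false {0} e :=
    hdet.start_unique [] _ hx₁ _ hx₂ evx₁ evx₂
  have ee : X.ev (X.face false {1} q) = [a] := by
    rw [X.ev_face _ _ _ hq1, hq]
    rfl
  have ef : X.ev (X.face true {0} q) = [b] := by
    rw [X.ev_face _ _ _ hq0, hq]
    rfl
  have h₁ : X.face false {0} (X.face false {1} q) = X.face false {0, 1} q := by
    have := X.face_union false {1} {0} q hq1 hq0 (by decide)
    rwa [show reindex {1} {0} = {0} by decide, show ({1} ∪ {0} : Finset ℕ) = {0, 1} by decide]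
      at this
  have h₂ : X.face true {0} (X.face true {0} q) = X.face true {0, 1} q := by
    have := X.face_union true {0} {1} q hq0 hq1 (by decide)
    rwa [show reindex {0} {1} = {0} by decide, show ({0} ∪ {1} : Finset ℕ) = {0, 1} by decide]
      at this
  -- The upper `b`-edge of the square starts where its lower `a`-edge ends. All indices are `{0}`
  -- because one event is left after the first face.
  have h₃ : X.face false {0} (X.face true {0} q) = X.face true {0} (X.face false {1} q) := by
    have := X.face_comm true false {0} {1} q hq0 hq1 (by decide)
    rwa [show reindex {0} {1} = {0} by decide, show reindex {1} {0} = {0} by decide] at this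
  have hmem : ∀ {z s}, X.ev z = [s] → ({0} : Finset ℕ) ⊆ X.events z := fun h =>
    subset_events_of_ev_eq (n := 1) h _ rfl (by decide)
  have x₁_ess : X.Essential (X.face false {0, 1} q) := ⟨⟨_, hx₁, ⟨.nil⟩⟩, ⟨_, hy₁, ⟨α₁⟩⟩⟩
  -- Both are `a`-edges leaving the common start vertex. Essentiality is witnessed by passing
  -- through the square for one and along the `abc` path for the other.
  have h_e : X.face false {1} q = e := by
    refine hdet.up_unique [a] {0} (by simp) _ x₁_ess (evx₁.trans rfl) _ _ ee he
      ⟨⟨_, hx₁, ⟨Path.nil.up _ {0} (hmem ee) h₁⟩⟩,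
        ⟨_, hy₁, ⟨(Path.nil.up q {1} hq1 rfl).down _ {0, 1} hq01 rfl⟩⟩⟩
      ⟨⟨_, hx₂, ⟨Path.nil.up _ {0} (hmem he) rfl⟩⟩, ⟨_, hy₂,
        ⟨((Path.nil.down _ {0} (hmem he) rfl).edge f hf hfe).edge g hg hgf⟩⟩⟩ h₁ hx.symm
  have v_ess : X.Essential (X.face true {0} e) :=
    ⟨⟨_, hx₂, ⟨Path.nil.edge e he rfl⟩⟩,
      ⟨_, hy₂, ⟨(Path.nil.edge f hf hfe).edge g hg hgf⟩⟩⟩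
  have ev_v : X.ev (X.face true {0} e) = [] := by
    rw [X.ev_face _ _ _ (hmem he), he]
    rfl
  -- By `h₃` and `h_e`, both are `b`-edges leaving the end of `e`.
  have h_f : X.face true {0} q = f := by
    refine hdet.up_unique [b] {0} (by simp) _ v_ess (ev_v.trans rfl) _ _ ef hf
      ⟨⟨_, hx₁, ⟨(Path.nil.up q {0, 1} hq01 rfl).down _ {0} hq0 rfl⟩⟩,
        ⟨_, hy₁, ⟨Path.nil.down _ {0} (hmem ef) h₂⟩⟩⟩
      ⟨⟨_, hx₂, ⟨(Path.nil.edge e he rfl).up f {0} (hmem hf) hfe⟩⟩, ⟨_, hy₂,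
        ⟨(Path.nil.down _ {0} (hmem hf) rfl).edge g hg hgf⟩⟩⟩ (h₃.trans (by rw [h_e])) hfe
  have hgq : X.face false {0} g = X.face true {0, 1} q := by
    rw [hgf, ← h_f, h₂]
  -- The forbidden path: the whole square, then `g`. Its event ipomset contains `c`, but has no
  -- precedence from `a` to `b`.
  obtain ⟨R, hR, -, hRp⟩ := (Path.HasEvent.square hab hq).edge hds (by simp [profile_pair]) hg hgq
    (by simp [profile_pair, hac.symm, hbc.symm])
  have hRL : R ∈ parWordLang a b c := hX ▸ ⟨_, hx₁, _, hy₂, _, hR⟩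
  rw [profile_pair] at hRp
  rcases (profile_of_mem_parWordLang hRL).2 with ⟨hE, -⟩ | ⟨-, hp, -⟩
  · have : c ∈ R.profile.events := by simp [hRp]
    rw [hE] at this
    simp [hac.symm, hbc.symm] at this
  · simp [hRp, hbc] at hp

end HDA

theorem removeAt_map {Sg Sg' : Type*} (f : Sg → Sg') (U : List Sg) (A : Finset ℕ) :
    removeAt (U.map f) A = (removeAt U A).map f := by
  induction U using List.reverseRecOn with
  | nil => rfl
  | append_singleton U s ih =>
    rw [List.map_append, List.map_singleton, removeAt_concat, removeAt_concat, ih, List.length_map]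
    by_cases h : U.length ∈ A <;> simp [h]

namespace HDA

open Ipomset

variable {Sg : Type u} {X : HDA.{u, v} Sg} {x y : X.cell}

theorem exists_path_word₂ {s t : Sg} (hst : s ≠ t) {e f : X.cell} (he : X.ev e = [s])
    (hf : X.ev f = [t]) (hef : X.face false {0} f = X.face true {0} e) :
    ∃ α : Path X (X.face false {0} e) (X.face true {0} f),
      α.HasEvent (word [s, t] false false) := by
  have h₀ : X.ev (X.face false {0} e) = [] := by
    rw [X.ev_face _ _ _ (subset_events_of_ev_eq (n := 1) he _ rfl (by decide)), he]
    rfl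
  have hn : (Path.nil : Path X (X.face false {0} e) _).HasEvent (idt []) := by
    rw [← h₀]
    rfl
  obtain ⟨P, hP, hPs, hPp⟩ := hn.edge idt_nil_simple (by simp [idt_nil_profile]) he rfl
    (by simp [idt_nil_profile])
  obtain ⟨R, hR, hRs, hRp⟩ := hP.edge hPs (by simp [hPp]) hf hef
    (by simp [hPp, idt_nil_profile, hst.symm])
  have : R = word [s, t] false false := by
    refine hRs.ext (word_simple (by simp [hst]) _ _) ?_
    rw [hRp, hPp, idt_nil_profile, profile_word₂]
    ext r r' <;> simp [or_comm]
  exact ⟨_, this ▸ hR⟩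

theorem exists_path_word₃ {a b c : Sg} (hab : a ≠ b) (hac : a ≠ c) (hbc : b ≠ c) {e f g : X.cell}
    (he : X.ev e = [a]) (hf : X.ev f = [b]) (hg : X.ev g = [c])
    (hef : X.face false {0} f = X.face true {0} e) (hfg : X.face false {0} g = X.face true {0} f) :
    ∃ α : Path X (X.face false {0} e) (X.face true {0} g),
      α.HasEvent (word [a, b, c] false false) := by
  obtain ⟨α, hα⟩ := exists_path_word₂ hab he hf hef
  obtain ⟨R, hR, hRs, hRp⟩ := hα.edge (word_simple (by simp [hab]) _ _)
    (by simp [profile_word₂]) hg hfg (by simp [profile_word₂, hac.symm, hbc.symm])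
  rw [profile_word₂] at hRp
  have : R = word [a, b, c] false false := eq_word₃ hab hac hbc hRs
    (by rw [hRp]; ext; simp; tauto) (by simp [hRp]) (by simp [hRp]) (by simp [hRp])
    (by simp [hRp]) (by simp [hRp])
  exact ⟨_, this ▸ hR⟩

end HDA

/-! ### A finite automaton for the language -/

namespace ParWord

open Ipomset

/-- The events in `ac`, in event order. -/
def evIdx (ac : Finset (Fin 3)) : List (Fin 3) := [0, 1, 2].filter (· ∈ ac)

/-- The events in `ac` except for those at the positions in `A`. -/
def remain (A : Finset ℕ) (ac : Finset (Fin 3)) : Finset (Fin 3) :=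
  (removeAt (evIdx ac) A).toFinset

theorem mem_evIdx (ac : Finset (Fin 3)) (i : Fin 3) : i ∈ evIdx ac ↔ i ∈ ac := by
  fin_cases i <;> simp [evIdx]

theorem evIdx_pairwise (ac : Finset (Fin 3)) : (evIdx ac).Pairwise (· < ·) :=
  List.Pairwise.filter _ (by decide)

theorem remain_subset (A : Finset ℕ) (ac : Finset (Fin 3)) : remain A ac ⊆ ac := fun i hi =>
  (mem_evIdx ac i).1 ((removeAt_sublist _ _).subset (List.mem_toFinset.1 hi))

theorem remain_empty (ac : Finset (Fin 3)) : remain ∅ ac = ac := by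
  revert ac
  decide

/-- Both lists are strictly increasing and have the same elements. -/
theorem evIdx_remain (A : Finset ℕ) (ac : Finset (Fin 3)) :
    evIdx (remain A ac) = removeAt (evIdx ac) A := by
  refine List.Perm.eq_of_pairwise (le := (· < ·)) (fun i j _ _ h h' => absurd h h'.asymm)
    (evIdx_pairwise _) ((evIdx_pairwise ac).sublist (removeAt_sublist _ _)) ?_
  refine (List.perm_ext_iff_of_nodup ((evIdx_pairwise _).imp ne_of_lt)
    (((evIdx_pairwise ac).sublist (removeAt_sublist _ _)).imp ne_of_lt)).2 fun i => ?_
  rw [mem_evIdx, remain, List.mem_toFinset]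

/-- Only finitely many cases occur. The second identity makes lower and upper faces commute: a lower
face un-starts the same events before and after an upper face for disjoint events. -/
theorem remain_reindex {ac : Finset (Fin 3)} {A B : Finset ℕ}
    (hA : A ⊆ Finset.range (evIdx ac).length) (hB : B ⊆ Finset.range (evIdx ac).length)
    (h : Disjoint A B) : remain (reindex A B) (remain A ac) = remain (A ∪ B) ac ∧
      remain B ac \ remain (A ∪ B) ac = ac \ remain A ac := by
  have key : ∀ ac : Finset (Fin 3), ∀ A ∈ (Finset.range (evIdx ac).length).powerset,
      ∀ B ∈ (Finset.range (evIdx ac).length).powerset, Disjoint A B →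
        remain (reindex A B) (remain A ac) = remain (A ∪ B) ac ∧
          remain B ac \ remain (A ∪ B) ac = ac \ remain A ac := by
    decide +kernel
  exact key ac A (Finset.mem_powerset.2 hA) B (Finset.mem_powerset.2 hB) h

/-- A cell is given by the branch it belongs to (`false` for `a ‖ b` and `true` for `abc`), the set
of events which have been started, and the set of events which are active. -/
abbrev CellData : Type := Bool × Finset (Fin 3) × Finset (Fin 3)

/-- The cells of the branch for `a ‖ b` only use the first two events, in the branch for `abc` an
event is only started when all previous events have been terminated. -/
def Valid (p : CellData) : Prop :=
  p.2.2 ⊆ p.2.1 ∧ (p.1 = false → 2 ∉ p.2.1) ∧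
    (p.1 = true → ∀ i j, i < j → j ∈ p.2.1 → i ∈ p.2.1 ∧ i ∉ p.2.2)

instance : DecidablePred Valid := fun _ => inferInstanceAs (Decidable (_ ∧ _ ∧ _))

/-- The face maps. -/
def faceData (ν : Bool) (A : Finset ℕ) (p : CellData) : CellData :=
  (p.1, if ν then p.2.1 else p.2.1 \ (p.2.2 \ remain A p.2.2), remain A p.2.2)

/-- In the `abc` branch, events below a started one are terminated, and a lower face un-starts only
active events, so these remain started. -/
theorem valid_faceData (ν : Bool) (A : Finset ℕ) {p : CellData} (hp : Valid p) :
    Valid (faceData ν A p) := by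
  obtain ⟨k, st, ac⟩ := p
  obtain ⟨h₁, h₂, h₃⟩ := hp
  have hr := remain_subset A ac
  have hst : (faceData ν A (k, st, ac)).2.1 ⊆ st := by
    cases ν
    · exact Finset.sdiff_subset
    · exact subset_rfl
  refine ⟨?_, fun hk h => h₂ hk (hst h), fun hk i j hij hj => ?_⟩
  · cases ν
    · intro i hi
      exact Finset.mem_sdiff.2 ⟨h₁ (hr hi), fun h => (Finset.mem_sdiff.1 h).2 hi⟩
    · exact hr.trans h₁
  · obtain ⟨hi, hi'⟩ := h₃ hk i j hij (hst hj)
    refine ⟨?_, fun h => hi' (hr h)⟩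
    cases ν
    · exact Finset.mem_sdiff.2 ⟨hi, fun h => hi' (Finset.mem_sdiff.1 h).1⟩
    · exact hi

variable {Sg : Type u} (lab : Fin 3 → Sg)

/-- The HDA for `{a ‖ b, abc}↓`. -/
def hda : HDA.{u, 0} Sg where
  cell := {p : CellData // Valid p}
  ev p := (evIdx p.1.2.2).map lab
  face ν A p := ⟨faceData ν A p.1, valid_faceData ν A p.2⟩
  ev_face ν A p _ := by
    rw [removeAt_map, ← evIdx_remain]
    rfl
  face_empty ν p := by
    obtain ⟨⟨k, st, ac⟩, -⟩ := p
    apply Subtype.ext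
    cases ν <;> simp [faceData, remain_empty]
  face_union ν A B p hA hB h := by
    obtain ⟨⟨k, st, ac⟩, hp⟩ := p
    simp only [List.length_map] at hA hB
    apply Subtype.ext
    obtain ⟨h₁, h₂⟩ := remain_reindex hA hB h
    have h₃ := remain_subset A ac
    have h₄ : remain (A ∪ B) ac ⊆ remain A ac := by
      rw [← h₁]
      exact remain_subset _ _
    cases ν
    · simp only [faceData, h₁]
      congr 2
      ext i
      have := @h₃ i
      have := @h₄ i
      simp
      tauto
    · simp [faceData, h₁]
  face_comm ν μ A B p hA hB h := by
    obtain ⟨⟨k, st, ac⟩, hp⟩ := p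
    simp only [List.length_map] at hA hB
    apply Subtype.ext
    obtain ⟨h₁, h₂⟩ := remain_reindex hA hB h
    obtain ⟨h₃, h₄⟩ := remain_reindex hB hA h.symm
    rw [Finset.union_comm] at h₃ h₄
    cases ν <;> cases μ
    · simp only [faceData, h₁, h₃, h₂, h₄]
      congr 2
      ext i
      simp
      tauto
    · simp [faceData, h₁, h₃, h₂]
    · simp [faceData, h₁, h₃, h₄]
    · simp [faceData, h₁, h₃]
  -- There are two start cells, one for each branch, both without events; so this HDA is not
  -- deterministic.
  start := {p | p.1.2.1 = ∅}
  accept := {p | p.1.2.2 = ∅ ∧ p.1.2.1 = if p.1.1 then Finset.univ else {0, 1}}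

/-! ### The language of the automaton: invariant and explicit paths. -/

variable {lab}

/-- The property of the event ipomsets of the paths from a start cell to a given cell. -/
structure Reaches (p : (hda lab).cell) (P : Ipomset Sg) : Prop where
  simple : P.Simple
  sources : P.profile.sources = ∅
  events : P.profile.events = lab '' p.1.2.1
  targets : P.profile.targets = lab '' p.1.2.2
  conc : ∀ s t, P.profile.conc s t → ∃ i j, i < j ∧ s = lab i ∧ t = lab j
  prec : p.1.1 = true → ∀ i j, i < j → j ∈ p.1.2.1 → P.profile.prec (lab i) (lab j)

theorem mem_ev (p : (hda lab).cell) (s : Sg) : s ∈ (hda lab).ev p ↔ s ∈ lab '' p.1.2.2 := by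
  change s ∈ (evIdx p.1.2.2).map lab ↔ _
  simp [mem_evIdx]

theorem ev_nodup (hlab : Function.Injective lab) (p : (hda lab).cell) :
    ((hda lab).ev p).Nodup :=
  List.Nodup.map hlab ((evIdx_pairwise p.1.2.2).imp ne_of_lt)

theorem ev_conc (p : (hda lab).cell) {S T} {s t : Sg}
    (h : (discrete ((hda lab).ev p) S T).profile.conc s t) :
    ∃ i j, i < j ∧ s = lab i ∧ t = lab j := by
  have hp : ((hda lab).ev p).Pairwise fun s t => ∃ i j, i < j ∧ s = lab i ∧ t = lab j :=
    List.pairwise_map.2 ((evIdx_pairwise p.1.2.2).imp fun h => ⟨_, _, h, rfl, rfl⟩)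
  obtain ⟨i, j, hij, rfl, rfl⟩ := (discrete_conc _ _ _ _ _).1 h
  exact List.pairwise_iff_get.1 hp i j hij

theorem image_get_ev (p : (hda lab).cell) (A : Finset ℕ) :
    ((hda lab).ev p).get '' {i | i.val ∉ A} = lab '' (remain A p.1.2.2) := by
  ext s
  rw [← mem_removeAt]
  change s ∈ removeAt ((evIdx p.1.2.2).map lab) A ↔ _
  rw [removeAt_map, ← evIdx_remain]
  simp [mem_evIdx]

theorem reaches_start {p : (hda lab).cell} (hp : p ∈ (hda lab).start) :
    Reaches p (idt ((hda lab).ev p)) := by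
  have hp : p.1.2.1 = ∅ := hp
  have hp' : p.1.2.2 = ∅ := Finset.subset_empty.1 (hp ▸ p.2.1)
  have hev : (hda lab).ev p = [] := by
    change (evIdx p.1.2.2).map lab = []
    rw [hp']
    rfl
  rw [hev]
  refine ⟨HDA.idt_nil_simple, ?_, ?_, ?_, ?_, ?_⟩
  all_goals simp [HDA.idt_nil_profile, hp, hp']

theorem Reaches.up (hlab : Function.Injective lab) {P R : Ipomset Sg} {p : (hda lab).cell}
    {A : Finset ℕ} (h : Reaches ((hda lab).face false A p) P)
    (hR : Glues P (starter ((hda lab).ev p) A) R) : Reaches p R := by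
  have hs : (starter ((hda lab).ev p) A).Simple := discrete_simple (ev_nodup hlab p) _ _
  have hsE : (starter ((hda lab).ev p) A).profile.events = lab '' p.1.2.2 := by
    ext s
    rw [starter, discrete_events]
    exact mem_ev p s
  have hE : P.profile.events = lab '' ↑(p.1.2.1 \ (p.1.2.2 \ remain A p.1.2.2)) := h.events
  have hT : P.profile.targets = lab '' ↑(remain A p.1.2.2) := h.targets
  have hr := remain_subset A p.1.2.2
  refine ⟨hR.simple_iff.2 ⟨h.simple, hs, ?_⟩, hR.sources.trans h.sources, ?_, ?_, ?_, ?_⟩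
  · rw [hE, hsE, hT, ← Set.image_inter hlab]
    refine Set.image_mono ?_
    rintro i ⟨hi, hi'⟩
    simp at hi hi'
    exact hi.2 hi'
  · rw [hR.events, hE, hsE, ← Set.image_union]
    congr 1
    ext i
    have := @p.2.1 i
    simp
    tauto
  · rw [hR.targets_starter.1]
    ext s
    exact mem_ev p s
  · intro s t hst
    rcases (hR.conc s t).1 hst with h' | h'
    · exact h.conc s t h'
    · exact ev_conc p h'
  · intro hk i j hij hj
    rw [hR.prec h.simple hs]
    obtain ⟨hi, hi'⟩ := p.2.2.2 hk i j hij hj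
    by_cases hj' : j ∈ p.1.2.1 \ (p.1.2.2 \ remain A p.1.2.2)
    · exact Or.inl (h.prec hk i j hij hj')
    -- Here `j` is started in this step, and validity says that `i` has already been terminated, so
    -- gluing puts `i` before `j`.
    · right; right
      rw [hE, hT, hsE, hlab.mem_set_image, hlab.mem_set_image, hlab.mem_set_image,
        hlab.mem_set_image]
      simp at hj' ⊢
      exact ⟨⟨⟨hi, fun h => absurd h hi'⟩, fun h => hi' (hr h)⟩, hj' hj⟩

theorem Reaches.down (hlab : Function.Injective lab) {P R : Ipomset Sg} {p : (hda lab).cell}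
    {B : Finset ℕ} (h : Reaches p P) (hR : Glues P (terminator ((hda lab).ev p) B) R) :
    Reaches ((hda lab).face true B p) R := by
  have hs : (terminator ((hda lab).ev p) B).Simple := discrete_simple (ev_nodup hlab p) _ _
  have hRs : R.Simple := by
    refine hR.simple_iff.2 ⟨h.simple, hs, fun s hs => ?_⟩
    rw [hR.targets_terminator.1]
    have := hs.2
    rwa [terminator, discrete_events] at this
  obtain ⟨hE, hp⟩ := hR.events_eq_of_terminator hRs
  refine ⟨hRs, hR.sources.trans h.sources, hE.trans h.events, ?_, ?_, ?_⟩
  · rw [hR.targets_terminator.2, image_get_ev]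
    rfl
  · intro s t hst
    rcases (hR.conc s t).1 hst with h' | h'
    · exact h.conc s t h'
    · exact ev_conc p h'
  · intro hk i j hij hj
    exact (hp _ _).2 (h.prec hk i j hij hj)

theorem reaches_of_hasEvent (hlab : Function.Injective lab) {x y : (hda lab).cell}
    (hx : x ∈ (hda lab).start) {α : HDA.Path (hda lab) x y} {P : Ipomset Sg}
    (h : α.HasEvent P) : Reaches y P := by
  induction α generalizing P with
  | nil =>
    obtain rfl := h
    exact reaches_start hx
  | up α z A hA hz ih =>
    obtain ⟨Q, hQ, hG⟩ := h
    subst hz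
    exact (ih hQ).up hlab hG
  | down α z B hB hz ih =>
    obtain ⟨Q, hQ, hG⟩ := h
    subst hz
    exact (ih hQ).down hlab hG

/-- In the first branch the invariant bounds concurrency, leaving `a ‖ b`, `ab` and `ba`; in the
second it forces all three precedences. -/
theorem Reaches.mem_parWordLang (hlab : Function.Injective lab) {p : (hda lab).cell}
    {P : Ipomset Sg} (h : Reaches p P) (hp : p ∈ (hda lab).accept) :
    P ∈ parWordLang (lab 0) (lab 1) (lab 2) := by
  obtain ⟨hac, hst⟩ := hp
  have hT : P.profile.targets = ∅ := by rw [h.targets, hac]; simp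
  have hE := h.events
  rw [hst] at hE
  cases hk : p.1.1
  · have hE : P.profile.events = {lab 0, lab 1} := by
      rw [hE, hk]
      simp [Set.image_pair]
    refine mem_parWordLang_of_events_eq_pair (hlab.ne (by decide)) h.simple hE h.sources hT
      fun s t hst => ?_
    obtain ⟨hs, ht⟩ := mem_events_of_conc hst
    obtain ⟨i, j, hij, rfl, rfl⟩ := h.conc s t hst
    simp only [hE, Set.mem_insert_iff, Set.mem_singleton_iff, hlab.eq_iff] at hs ht ⊢
    omega
  · have hprec : ∀ i j, i < j → P.profile.prec (lab i) (lab j) := fun i j hij =>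
      h.prec hk i j hij (by simp [hst, hk])
    refine Or.inr (Or.inr (Or.inr (eq_word₃ (hlab.ne (by decide)) (hlab.ne (by decide))
      (hlab.ne (by decide)) h.simple ?_ h.sources hT (hprec _ _ (by decide))
      (hprec _ _ (by decide)) (hprec _ _ (by decide)))))
    rw [hE, hk]
    ext s
    simp [Fin.exists_fin_succ, eq_comm]

/-- The cell with the given data. -/
def mkCell (lab : Fin 3 → Sg) (k : Bool) (st ac : Finset (Fin 3))
    (h : Valid (k, st, ac) := by decide) : (hda lab).cell := ⟨(k, st, ac), h⟩

theorem lang_hda (hlab : Function.Injective lab) :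
    (hda lab).lang = parWordLang (lab 0) (lab 1) (lab 2) := by
  have h01 : lab 0 ≠ lab 1 := hlab.ne (by decide)
  have h02 : lab 0 ≠ lab 2 := hlab.ne (by decide)
  have h12 : lab 1 ≠ lab 2 := hlab.ne (by decide)
  ext P
  constructor
  · rintro ⟨x, hx, y, hy, α, hα⟩
    exact (reaches_of_hasEvent hlab hx hα).mem_parWordLang hlab hy
  have hface : ∀ {p q : (hda lab).cell} {ν μ A B}, faceData ν A p.1 = faceData μ B q.1 →
      (hda lab).face ν A p = (hda lab).face μ B q :=
    fun h => Subtype.ext h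
  have hstart : ∀ {p : (hda lab).cell}, p.1.2.1 = ∅ → p ∈ (hda lab).start := id
  have haccept : ∀ {p : (hda lab).cell},
      p.1 = (false, {0, 1}, ∅) ∨ p.1 = (true, Finset.univ, ∅) → p ∈ (hda lab).accept := by
    rintro ⟨p, hp⟩ (rfl | rfl) <;> exact ⟨rfl, rfl⟩
  rintro (rfl | rfl | rfl | rfl)
  · refine ⟨_, ?_, _, ?_, _, HDA.Path.HasEvent.square h01
      (q := mkCell lab false {0, 1} {0, 1}) rfl⟩
    · exact hstart (show (faceData false {0, 1} (false, {0, 1}, {0, 1})).2.1 = ∅ by decide)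
    · exact haccept (Or.inl (show faceData true {0, 1} (false, {0, 1}, {0, 1}) =
        (false, {0, 1}, ∅) by decide))
  -- The words `ab` and `ba` run along the boundary of the square; the second edge has both events
  -- started but only one active.
  · obtain ⟨α, hα⟩ := HDA.exists_path_word₂ (X := hda lab) h01 (e := mkCell lab false {0} {0})
      (f := mkCell lab false {0, 1} {1}) rfl rfl
      (hface (show faceData false {0} (false, {0, 1}, {1}) =
        faceData true {0} (false, {0}, {0}) by decide))
    refine ⟨_, ?_, _, ?_, α, hα⟩
    · exact hstart (show (faceData false {0} (false, {0}, {0})).2.1 = ∅ by decide)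
    · exact haccept (Or.inl (show faceData true {0} (false, {0, 1}, {1}) =
        (false, {0, 1}, ∅) by decide))
  · obtain ⟨α, hα⟩ := HDA.exists_path_word₂ (X := hda lab) h01.symm
      (e := mkCell lab false {1} {1}) (f := mkCell lab false {0, 1} {0}) rfl rfl
      (hface (show faceData false {0} (false, {0, 1}, {0}) =
        faceData true {0} (false, {1}, {1}) by decide))
    refine ⟨_, ?_, _, ?_, α, hα⟩
    · exact hstart (show (faceData false {0} (false, {1}, {1})).2.1 = ∅ by decide)
    · exact haccept (Or.inl (show faceData true {0} (false, {0, 1}, {0}) =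
        (false, {0, 1}, ∅) by decide))
  · obtain ⟨α, hα⟩ := HDA.exists_path_word₃ (X := hda lab) h01 h02 h12
      (e := mkCell lab true {0} {0}) (f := mkCell lab true {0, 1} {1})
      (g := mkCell lab true {0, 1, 2} {2}) rfl rfl rfl
      (hface (show faceData false {0} (true, {0, 1}, {1}) =
        faceData true {0} (true, {0}, {0}) by decide))
      (hface (show faceData false {0} (true, {0, 1, 2}, {2}) =
        faceData true {0} (true, {0, 1}, {1}) by decide))
    refine ⟨_, ?_, _, ?_, α, hα⟩
    · exact hstart (show (faceData false {0} (true, {0}, {0})).2.1 = ∅ by decide)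
    · exact haccept (Or.inr (show faceData true {0} (true, {0, 1, 2}, {2}) =
        (true, Finset.univ, ∅) by decide))

theorem exists_finite_hda {a b c : Sg} (hab : a ≠ b) (hac : a ≠ c) (hbc : b ≠ c) :
    ∃ X : HDA.{u, 0} Sg, Finite X.cell ∧ X.lang = parWordLang a b c := by
  have hlab : Function.Injective ![a, b, c] := by
    intro i j h
    fin_cases i <;> fin_cases j <;> simp_all
  exact ⟨hda ![a, b, c], inferInstanceAs (Finite {p : CellData // Valid p}), lang_hda hlab⟩

end ParWord

/-! ### The main theorem. -/

theorem mainTheorem3 {Sg : Type u} [Finite Sg] (a b c : Sg) (hab : a ≠ b) (hac : a ≠ c)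
    (hbc : b ≠ c)
    -- the four elements `a ‖ b`, `ab`, `ba`, `abc` of the language `L`
    (par ab ba abc : Ipomset Sg)
    (hpar : par = Ipomset.discrete [a, b] ∅ ∅)
    (hw_ab : ab = Ipomset.word [a, b] false false)
    (hw_ba : ba = Ipomset.word [b, a] false false)
    (hw_abc : abc = Ipomset.word [a, b, c] false false)
    (L : Set (Ipomset Sg)) (hL : L = {par, ab, ba, abc})
    -- the ipomsets `ab•` and `a ‖ b•`
    (abT parT : Ipomset Sg)
    (hw_abT : abT = Ipomset.word [a, b] false true)
    (hparT : parT = Ipomset.discrete [a, b] ∅ {i | i.val = 1}) :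
    -- `L` is the language `{a ‖ b, abc}↓`, and it is regular
    Ipomset.IsLanguage L ∧ Ipomset.down {par, abc} = L ∧ IsRegularLanguage L ∧
    -- `ab• ⊑ a ‖ b•`, with the prefix quotients `{•b, •bc}` and `{•b}`
    Ipomset.Subsumed abT parT ∧
    Ipomset.prefixQuotient abT L = {Ipomset.word [b] true false, Ipomset.word [b, c] true false} ∧
    Ipomset.prefixQuotient parT L = {Ipomset.word [b] true false} ∧
    Ipomset.prefixQuotient abT L ≠ Ipomset.prefixQuotient parT L ∧
    ¬ Ipomset.SwapInvariant L ∧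
    -- no deterministic HDA recognises `L`, hence not every finite HDA is determinizable
    ¬ IsDeterministicLanguage.{u, v} L ∧
    ∃ X : HDA.{u, 0} Sg, Finite X.cell ∧ X.lang = L ∧
      ∀ Y : HDA.{u, v} Sg, Y.Deterministic → Y.lang ≠ X.lang := by
  subst hpar hw_ab hw_ba hw_abc hw_abT hparT
  change L = Ipomset.parWordLang a b c at hL
  subst hL
  obtain ⟨X, hX, hXL⟩ := ParWord.exists_finite_hda hab hac hbc
  refine ⟨Ipomset.isLanguage_parWordLang hab hac hbc, Ipomset.down_eq_parWordLang hab hac hbc,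
    ⟨X, hX, hXL⟩, Ipomset.subsumed_word_discrete hab, Ipomset.prefixQuotient_word hab hac hbc,
    Ipomset.prefixQuotient_discrete hab hac hbc, ?_,
    Ipomset.not_swapInvariant_parWordLang hab hac hbc, ?_, X, hX, hXL, ?_⟩
  · rw [Ipomset.prefixQuotient_word hab hac hbc, Ipomset.prefixQuotient_discrete hab hac hbc]
    intro h
    exact Ipomset.word₂_ne_word₁ hbc (h.subset (Or.inr rfl))
  · rintro ⟨Y, hY, hYL⟩
    exact HDA.not_deterministic_of_lang_eq hab hac hbc hYL hY
  · exact fun Y hY hYL => HDA.not_deterministic_of_lang_eq hab hac hbc (hYL.trans hXL) hY
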